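/- Manifolds are smooth ($C^\infty$), finite-dimensional and without boundary. For a Riemannian manifold $M$, $d_M$ denotes its Riemannian distance (the infimum of the lengths of $C^1$ curves joining two points, equal to $\infty$ if there is none). Let $M$, $N$ be Riemannian manifolds and let $F:M\to N$ be a Lipschitz map. For $x\in M$, the generalized differential of $F$ at $x$ in the sense of Clarke is \[ \partial F(x):=\operatorname{Conv}\Bigl\{\lim_{i\to\infty}dF_{x_i}\ \Bigm|\ x_i\to x,\ F \text{ is differentiable at every } x_i,\ \text{the limit exists}\Bigr\}, \] a set of linear maps $T_xM\to T_{F(x)}N$, where $\operatorname{Conv}$ is the convex hull and the limits are taken in local charts around $x$ and $F(x)$. The point $x$ is called non-singular for $F$ if every element of $\partial F(x)$ has maximal rank $\min(\dim M,\dim N)$, and singular otherwise. Theorem. Let $F$ be a bi-Lipschitz homeomorphism from a compact Riemannian manifold $M$ onto a Riemannian manifold $N$; that is, $F$ is a homeomorphism, and $F$ and $F^{-1}$ are Lipschitz with respect to $d_M$ and $d_N$. If $F$ has no singular points on $M$ and $F^{-1}$ has no singular points on $N$, then $M$ and $N$ are ($C^\infty$-)diffeomorphic. -/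

import Mathlib

open Set Filter Topology
open scoped NNReal Manifold ContDiff Bundle

noncomputable section

section Clarke

variable {E : Type*} [NormedAddCommGroup E] [NormedSpace ℝ E]
  {H : Type*} [TopologicalSpace H] (I : ModelWithCorners ℝ E H)
  {M : Type*} [TopologicalSpace M] [ChartedSpace H M]
  {E' : Type*} [NormedAddCommGroup E'] [NormedSpace ℝ E']
  {H' : Type*} [TopologicalSpace H'] (J : ModelWithCorners ℝ E' H')
  {N : Type*} [TopologicalSpace N] [ChartedSpace H' N]

/-- The linear maps `A : T_x M → T_{F x} N` of the form `lim dF_{x_i}`, where `x_i → x` is a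
sequence of points at which `F` is differentiable. The tangent spaces at points near `x` and near
`F x` are identified with the model spaces `E` and `E'` through the preferred charts at `x` and at
`F x` (at `x` and `F x` themselves this is Mathlib's identification of `TangentSpace I x` with `E`
and of `TangentSpace J (F x)` with `E'`), so that `dF_{x_i}` is the derivative, at the image of
`x_i`, of the expression of `F` in these two charts. Another choice of charts composes the limits
with fixed linear isomorphisms on both sides. -/
def limitDifferentials (F : M → N) (x : M) : Set (E →L[ℝ] E') :=
  {A | ∃ u : ℕ → M, (∀ i, MDifferentiableAt I J F (u i)) ∧ Tendsto u atTop (𝓝 x) ∧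
    Tendsto (fun i => fderivWithin ℝ (writtenInExtChartAt I J x F) (range I)
      (extChartAt I x (u i))) atTop (𝓝 A)}

/-- Clarke's generalized differential `∂F(x)`: the convex hull of the limits of differentials. -/
def generalizedDifferential (F : M → N) (x : M) : Set (E →L[ℝ] E') :=
  convexHull ℝ (limitDifferentials I J F x)

/-- `x` is non-singular for `F` in the sense of Clarke: every element of `∂F(x)` has maximal rank,
that is, rank `min (dim M) (dim N)`. -/
def IsClarkeNonsingularAt (F : M → N) (x : M) : Prop :=
  ∀ A ∈ generalizedDifferential I J F x,
    Module.finrank ℝ (LinearMap.range (A : E →ₗ[ℝ] E')) =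
      min (Module.finrank ℝ E) (Module.finrank ℝ E')

end Clarke

end

/-!
By non-singularity at `x`, no element of the compact convex set `∂F(x)` kills a step `v`, so
Hahn–Banach yields a functional `w` of norm at most `1` with `w (A v) ≥ δ ‖v‖` for all
`A ∈ ∂F(x)`. Integrating along segments, `w` then detects all increments of `F` along `v` at once,
uniformly near `x`. This coercivity is preserved by mollification, whereas being bi-Lipschitz is
not. Mollifying in finitely many charts, and blending with the previous map by cutoffs, produces
smooth coercive embeddings arbitrarily close to `F`. As `F` is bi-Lipschitz, `M` and `N` have the
same dimension, so the derivatives of such an embedding `g` are invertible and `g` is a local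
diffeomorphism with open and closed image. If `g` is so close to `F` that `g x` and `F x` always
lie in the same component, then `g` is surjective, hence a diffeomorphism.
-/

section Increments

variable {G G' : Type*} [AddCommGroup G] [AddCommGroup G'] {h k : G → G'} {U V : Set G}

/-- The increments of `h` along the translates of the step `v` with both endpoints in `U`. -/
def increments (h : G → G') (U : Set G) (v : G) : Set G' :=
  {u | ∃ y ∈ U, y + v ∈ U ∧ h (y + v) - h y = u}

theorem sub_mem_increments {x y : G} (hx : x ∈ U) (hy : y ∈ U) :
    h x - h y ∈ increments h U (x - y) :=
  ⟨y, hy, by simpa using hx, by simp⟩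

theorem increments_mono (hVU : V ⊆ U) (v : G) : increments h V v ⊆ increments h U v := by
  rintro _ ⟨y, hy, hyv, rfl⟩
  exact ⟨y, hVU hy, hVU hyv, rfl⟩

theorem increments_congr (hk : EqOn k h U) (v : G) : increments k U v = increments h U v :=
  Set.ext fun u => exists_congr fun y => and_congr_right fun hy => and_congr_right fun hyv => by
    rw [hk hy, hk hyv]

end Increments

section Coercive

variable {E : Type*} [NormedAddCommGroup E]
  {E' : Type*} [NormedAddCommGroup E'] [NormedSpace ℝ E']
  {E'' : Type*} [NormedAddCommGroup E''] [NormedSpace ℝ E'']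
  {h k : E → E'} {U V : Set E} {C c : ℝ≥0} {p : E}

/-- `h` is Lipschitz on `U` and, for each step `v`, one bounded functional detects all increments
of `h` along `v` at once. These conditions on the increments are closed and convex, so they
survive averaging; this is what is gained over being bi-Lipschitz on `U`. -/
def CoerciveOn (h : E → E') (U : Set E) (C : ℝ≥0) : Prop :=
  ∀ v, ∃ w : E' →L[ℝ] ℝ, ‖w‖ ≤ C ∧ ∀ u ∈ increments h U v, ‖v‖ ≤ w u ∧ ‖u‖ ≤ C * ‖v‖

/-- `h` is coercive on a neighbourhood of `p`. -/
def CoerciveAt (h : E → E') (p : E) : Prop :=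
  ∃ C, ∃ U ∈ 𝓝 p, CoerciveOn h U C

namespace CoerciveOn

theorem of_subset (H : CoerciveOn h U C) (hk : ∀ v, increments k V v ⊆ increments h U v) :
    CoerciveOn k V C := fun v =>
  let ⟨w, hw, hu⟩ := H v
  ⟨w, hw, fun u hu' => hu u (hk v hu')⟩

theorem mono (H : CoerciveOn h U C) (hVU : V ⊆ U) : CoerciveOn h V C :=
  H.of_subset (increments_mono hVU)

theorem congr (H : CoerciveOn h U C) (hk : EqOn k h U) : CoerciveOn k U C :=
  H.of_subset fun v => (increments_congr hk v).subset

theorem lipschitzOnWith (H : CoerciveOn h U C) : LipschitzOnWith C h U :=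
  LipschitzOnWith.of_dist_le_mul fun x hx y hy => by
    obtain ⟨w, -, hu⟩ := H (x - y)
    simpa only [dist_eq_norm] using (hu _ (sub_mem_increments hx hy)).2

theorem continuousOn (H : CoerciveOn h U C) : ContinuousOn h U :=
  H.lipschitzOnWith.continuousOn

theorem norm_sub_le_mul_norm_sub (H : CoerciveOn h U C) {x y : E} (hx : x ∈ U) (hy : y ∈ U) :
    ‖x - y‖ ≤ C * ‖h x - h y‖ := by
  obtain ⟨w, hw, hu⟩ := H (x - y)
  calc ‖x - y‖ ≤ w (h x - h y) := (hu _ (sub_mem_increments hx hy)).1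
    _ ≤ ‖w (h x - h y)‖ := Real.le_norm_self _
    _ ≤ C * ‖h x - h y‖ := w.le_of_opNorm_le hw _

theorem injOn (H : CoerciveOn h U C) : InjOn h U := fun x hx y hy hxy => by
  simpa [hxy, sub_eq_zero] using H.norm_sub_le_mul_norm_sub hx hy

theorem exists_functional_closedConvexHull (H : CoerciveOn h U C) (v : E) :
    ∃ w : E' →L[ℝ] ℝ, ‖w‖ ≤ C ∧
      ∀ u ∈ closedConvexHull ℝ (increments h U v), ‖v‖ ≤ w u ∧ ‖u‖ ≤ C * ‖v‖ := by
  obtain ⟨w, hw, hu⟩ := H v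
  have hclosed : IsClosed {u | ‖v‖ ≤ w u ∧ ‖u‖ ≤ C * ‖v‖} :=
    (isClosed_le continuous_const w.continuous).inter (isClosed_le continuous_norm continuous_const)
  have hconvex : Convex ℝ {u | ‖v‖ ≤ w u ∧ ‖u‖ ≤ C * ‖v‖} := by
    have hball : Convex ℝ {u : E' | ‖u‖ ≤ C * ‖v‖} := by
      simpa only [Metric.closedBall, dist_zero_right] using convex_closedBall (0 : E') (C * ‖v‖)
    exact (convex_halfSpace_ge w.isLinear _).inter hball
  exact ⟨w, hw, fun u hu' => closedConvexHull_min hu hconvex hclosed hu'⟩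

/-- The constant `2 C + c` arises by doubling the detecting functional, so that an error of half
the step is absorbed. -/
theorem of_near_closedConvexHull (H : CoerciveOn h U C) (hc : C * c ≤ 1 / 2)
    (hk : ∀ v, ∀ u ∈ increments k V v,
      ∃ u' ∈ closedConvexHull ℝ (increments h U v), ‖u - u'‖ ≤ c * ‖v‖) :
    CoerciveOn k V (2 * C + c) := fun v => by
  obtain ⟨w, hw, hu⟩ := H.exists_functional_closedConvexHull v
  refine ⟨(2 : ℝ) • w, ?_, fun u hu' => ?_⟩
  · push_cast
    rw [norm_smul, Real.norm_two]
    linarith [c.coe_nonneg]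
  obtain ⟨u', hu', herr⟩ := hk v u hu'
  obtain ⟨hlower, hupper⟩ := hu u' hu'
  have hc' : (C * c : ℝ) ≤ 1 / 2 := by exact_mod_cast hc
  have hw_err : |w (u - u')| ≤ 1 / 2 * ‖v‖ :=
    calc |w (u - u')| ≤ C * (c * ‖v‖) := (w.le_of_opNorm_le hw _).trans (by gcongr)
      _ ≤ 1 / 2 * ‖v‖ := by rw [← mul_assoc]; gcongr
  constructor
  · have := neg_abs_le (w (u - u'))
    rw [map_sub] at this hw_err
    simp only [smul_apply, smul_eq_mul]
    linarith
  · calc ‖u‖ ≤ ‖u'‖ + ‖u - u'‖ := norm_le_norm_add_norm_sub' u u'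
      _ ≤ C * ‖v‖ + c * ‖v‖ := by gcongr
      _ ≤ (2 * C + c : ℝ≥0) * ‖v‖ := by
        push_cast
        nlinarith [mul_nonneg C.coe_nonneg (norm_nonneg v)]

theorem continuousLinearEquiv_comp (H : CoerciveOn h U C) (B : E' ≃L[ℝ] E'') :
    ∃ D, CoerciveOn (B ∘ h) U D := by
  refine ⟨max (C * ‖(B.symm : E'' →L[ℝ] E')‖₊) (‖(B : E' →L[ℝ] E'')‖₊ * C), fun v => ?_⟩
  obtain ⟨w, hw, hu⟩ := H v
  refine ⟨w.comp (B.symm : E'' →L[ℝ] E'), ?_, ?_⟩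
  · rw [NNReal.coe_max]
    exact ((w.opNorm_comp_le _).trans (by push_cast; gcongr)).trans (le_max_left _ _)
  rintro _ ⟨y, hy, hyv, rfl⟩
  obtain ⟨hlower, hupper⟩ := hu _ ⟨y, hy, hyv, rfl⟩
  simp only [Function.comp_apply, ← map_sub]
  constructor
  · simpa using hlower
  · calc ‖B (h (y + v) - h y)‖ ≤ ‖(B : E' →L[ℝ] E'')‖ * (C * ‖v‖) :=
          (B : E' →L[ℝ] E'').le_opNorm_of_le hupper
      _ ≤ _ := by
        rw [← mul_assoc]
        gcongr
        exact le_max_right _ _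

theorem coerciveAt_of_eventually_near (H : CoerciveOn h U C) (hc : C * c ≤ 1 / 2)
    (hk : ∀ᶠ q : E × E in 𝓝 (p, p), ∃ u ∈ increments h U (q.1 - q.2),
      ‖k q.1 - k q.2 - u‖ ≤ c * ‖q.1 - q.2‖) : CoerciveAt k p := by
  rw [nhds_prod_eq, eventually_prod_self_iff'] at hk
  obtain ⟨V, hV, hnear⟩ := hk
  refine ⟨2 * C + c, V, hV, H.of_near_closedConvexHull hc ?_⟩
  rintro v _ ⟨y, hy, hyv, rfl⟩
  obtain ⟨u, hu, herr⟩ := hnear (y + v) hyv y hy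
  rw [add_sub_cancel_left] at hu herr
  exact ⟨u, subset_closedConvexHull hu, herr⟩

end CoerciveOn

theorem exists_pos_mul_le_half (C : ℝ≥0) : ∃ c : ℝ≥0, 0 < c ∧ C * c ≤ 1 / 2 := by
  refine ⟨(2 * (C + 1))⁻¹, by positivity, ?_⟩
  rw [mul_inv, ← mul_assoc, mul_comm C, mul_assoc, one_div]
  exact mul_le_of_le_one_right' (mul_inv_le_one_of_le₀ (by simp) (by simp))

namespace CoerciveAt

theorem continuousAt (H : CoerciveAt h p) : ContinuousAt h p :=
  let ⟨_, _, hU, H⟩ := H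
  H.continuousOn.continuousAt hU

theorem congr (H : CoerciveAt h p) (hk : k =ᶠ[𝓝 p] h) : CoerciveAt k p :=
  let ⟨C, U, hU, H⟩ := H
  ⟨C, U ∩ {x | k x = h x}, inter_mem hU hk, (H.mono inter_subset_left).congr fun _ hx => hx.2⟩

theorem comp_left (H : CoerciveAt h p) {ψ : E' → E''} {B : E' ≃L[ℝ] E''}
    (hψ : HasStrictFDerivAt ψ (B : E' →L[ℝ] E'') (h p)) : CoerciveAt (ψ ∘ h) p := by
  have hcont := H.continuousAt
  obtain ⟨C, U, hU, H⟩ := H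
  obtain ⟨D, HB⟩ := H.continuousLinearEquiv_comp B
  obtain ⟨c, hc, hDc⟩ := exists_pos_mul_le_half (D * C)
  rw [mul_assoc, mul_comm C] at hDc
  refine HB.coerciveAt_of_eventually_near hDc ?_
  have hψ' : ∀ᶠ q : E × E in 𝓝 (p, p),
      ‖ψ (h q.1) - ψ (h q.2) - B (h q.1 - h q.2)‖ ≤ c * ‖h q.1 - h q.2‖ :=
    (hcont.prodMap' hcont).eventually (hψ.isLittleO.def hc)
  filter_upwards [hψ', prod_mem_nhds hU hU] with q hq ⟨hq₁, hq₂⟩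
  refine ⟨_, sub_mem_increments hq₁ hq₂, ?_⟩
  calc ‖ψ (h q.1) - ψ (h q.2) - (B (h q.1) - B (h q.2))‖ ≤ c * ‖h q.1 - h q.2‖ := by
        simpa using hq
    _ ≤ (c * C : ℝ≥0) * ‖q.1 - q.2‖ := by
      push_cast
      rw [mul_assoc]
      gcongr
      exact H.lipschitzOnWith.norm_sub_le hq₁ hq₂

end CoerciveAt

variable [NormedSpace ℝ E]

theorem CoerciveOn.comp_continuousLinearEquiv (H : CoerciveOn h U C) (A : E'' ≃L[ℝ] E) :
    ∃ D, CoerciveOn (h ∘ A) (A ⁻¹' U) D := by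
  refine ⟨max (‖(A.symm : E →L[ℝ] E'')‖₊ * C) (C * ‖(A : E'' →L[ℝ] E)‖₊), fun v => ?_⟩
  obtain ⟨w, hw, hu⟩ := H (A v)
  refine ⟨‖(A.symm : E →L[ℝ] E'')‖ • w, ?_, ?_⟩
  · rw [NNReal.coe_max, norm_smul, norm_norm]
    exact (by push_cast; gcongr : _ ≤ _).trans (le_max_left _ _)
  rintro _ ⟨y, hy, hyv, rfl⟩
  obtain ⟨hlower, hupper⟩ := hu (h (A (y + v)) - h (A y))
    ⟨A y, hy, by simpa using hyv, by rw [map_add]⟩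
  constructor
  · calc ‖v‖ = ‖A.symm (A v)‖ := by simp
      _ ≤ ‖(A.symm : E →L[ℝ] E'')‖ * ‖A v‖ := (A.symm : E →L[ℝ] E'').le_opNorm _
      _ ≤ _ := by simpa using mul_le_mul_of_nonneg_left hlower (norm_nonneg _)
  · calc ‖h (A (y + v)) - h (A y)‖ ≤ C * (‖(A : E'' →L[ℝ] E)‖ * ‖v‖) :=
          hupper.trans (by gcongr; exact (A : E'' →L[ℝ] E).le_opNorm v)
      _ ≤ _ := by
        rw [← mul_assoc]
        gcongr
        exact le_max_right _ _

theorem CoerciveAt.comp_right {φ : E'' → E} {p : E''} (H : CoerciveAt h (φ p)) {A : E'' ≃L[ℝ] E}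
    (hφ : HasStrictFDerivAt φ (A : E'' →L[ℝ] E) p) : CoerciveAt (h ∘ φ) p := by
  obtain ⟨C, U, hU, H⟩ := H
  obtain ⟨D, HA⟩ := H.comp_continuousLinearEquiv A
  obtain ⟨c, hc, hDc⟩ := exists_pos_mul_le_half (D * C)
  rw [mul_assoc] at hDc
  refine HA.coerciveAt_of_eventually_near hDc ?_
  have hφ₁ : ContinuousAt (fun q : E'' × E'' => φ q.1) (p, p) := hφ.continuousAt.fst'
  have hφ₂ : ContinuousAt (fun q : E'' × E'' => φ q.2) (p, p) := hφ.continuousAt.snd'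
  have hstep : ContinuousAt (fun q : E'' × E'' => φ q.2 + A (q.1 - q.2)) (p, p) :=
    hφ₂.add (by fun_prop)
  filter_upwards [hφ.isLittleO.def hc, hφ₁ hU, hφ₂ hU, hstep (by simpa using hU)]
    with q hq hq₁ hq₂ hq₃
  refine ⟨h (φ q.2 + A (q.1 - q.2)) - h (φ q.2),
    ⟨A.symm (φ q.2), by simpa using hq₂, by simpa using hq₃, by simp⟩, ?_⟩
  calc ‖h (φ q.1) - h (φ q.2) - (h (φ q.2 + A (q.1 - q.2)) - h (φ q.2))‖
      = ‖h (φ q.1) - h (φ q.2 + A (q.1 - q.2))‖ := by rw [sub_sub_sub_cancel_right]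
    _ ≤ C * ‖φ q.1 - (φ q.2 + A (q.1 - q.2))‖ := H.lipschitzOnWith.norm_sub_le hq₁ hq₃
    _ ≤ (C * c : ℝ≥0) * ‖q.1 - q.2‖ := by
      push_cast
      rw [mul_assoc, ← sub_sub]
      gcongr
      exact hq

theorem CoerciveAt.injective_of_hasFDerivAt (H : CoerciveAt h p) {A : E →L[ℝ] E'}
    (hA : HasFDerivAt h A p) : Function.Injective A := by
  obtain ⟨C, U, hU, H⟩ := H
  refine (injective_iff_map_eq_zero A).2 fun v hv => ?_
  have hlim : Tendsto (fun t : ℝ => t • (h (p + t⁻¹ • v) - h p)) atTop (𝓝 (A v)) :=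
    hA.lim_real v
  have hmem : ∀ᶠ t : ℝ in atTop, p + t⁻¹ • v ∈ U := by
    have : Tendsto (fun t : ℝ => p + t⁻¹ • v) atTop (𝓝 (p + (0 : ℝ) • v)) :=
      tendsto_const_nhds.add (tendsto_inv_atTop_zero.smul_const v)
    exact this (by simpa using hU)
  have hle : ∀ᶠ t : ℝ in atTop, ‖v‖ ≤ C * ‖t • (h (p + t⁻¹ • v) - h p)‖ := by
    filter_upwards [hmem, eventually_gt_atTop 0] with t ht ht₀
    have := H.norm_sub_le_mul_norm_sub ht (mem_of_mem_nhds hU)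
    rw [add_sub_cancel_left, norm_smul, norm_inv, Real.norm_of_nonneg ht₀.le,
      inv_mul_le_iff₀ ht₀] at this
    rwa [norm_smul, Real.norm_of_nonneg ht₀.le, mul_left_comm]
  have hAv : ‖v‖ ≤ C * ‖A v‖ := ge_of_tendsto (hlim.norm.const_mul _) hle
  simpa [hv] using hAv

end Coercive

section Mollification

open MeasureTheory
open scoped Convolution

theorem integral_smul_mem_of_convex {α E' : Type*} [MeasurableSpace α] {μ : Measure α}
    [NormedAddCommGroup E'] [NormedSpace ℝ E'] [CompleteSpace E'] {S : Set E'} (hS : Convex ℝ S)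
    (hSc : IsClosed S) {ρ : α → ℝ} (hρ : Measurable ρ) (hρ₀ : ∀ z, 0 ≤ ρ z)
    (hρ₁ : ∫ z, ρ z ∂μ = 1) {g : α → E'} (hg : Integrable (fun z => ρ z • g z) μ)
    (hgS : ∀ z ∈ Function.support ρ, g z ∈ S) : ∫ z, ρ z • g z ∂μ ∈ S := by
  have hρint : Integrable ρ μ := .of_integral_ne_zero (by simp [hρ₁])
  have hρm : Measurable fun z => ENNReal.ofReal (ρ z) := hρ.ennreal_ofReal
  have hρ_toReal (z : α) : (ENNReal.ofReal (ρ z)).toReal = ρ z := ENNReal.toReal_ofReal (hρ₀ z)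
  have hfin : ∀ᵐ z ∂μ, ENNReal.ofReal (ρ z) < ⊤ := .of_forall fun _ => ENNReal.ofReal_lt_top
  let ν : Measure α := μ.withDensity fun z => ENNReal.ofReal (ρ z)
  have hν : IsProbabilityMeasure ν := ⟨by
    rw [withDensity_apply _ MeasurableSet.univ, Measure.restrict_univ,
      ← ofReal_integral_eq_lintegral_ofReal hρint (.of_forall hρ₀), hρ₁, ENNReal.ofReal_one]⟩
  have hgν : Integrable g ν := by
    rw [integrable_withDensity_iff_integrable_smul' hρm hfin]
    simpa only [hρ_toReal] using hg
  have hae : ∀ᵐ z ∂ν, g z ∈ S :=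
    (ae_withDensity_iff hρm).2 <| .of_forall fun z hz => hgS z fun h => hz (by simp [h])
  have hmem := hS.integral_mem hSc hae hgν
  rw [integral_withDensity_eq_integral_toReal_smul hρm hfin] at hmem
  simpa only [hρ_toReal] using hmem

/-- A sequence of bump functions at the origin with supports shrinking to a point. -/
noncomputable def shrinkingBump (E : Type*) [NormedAddCommGroup E] (j : ℕ) :
    ContDiffBump (0 : E) where
  rIn := 1 / (2 * ((j : ℝ) + 1))
  rOut := 1 / ((j : ℝ) + 1)
  rIn_pos := by positivity
  rIn_lt_rOut := one_div_lt_one_div_of_lt (by positivity) (by linarith [j.cast_nonneg (α := ℝ)])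

theorem tendsto_rOut_shrinkingBump (E : Type*) [NormedAddCommGroup E] :
    Tendsto (fun j => (shrinkingBump E j).rOut) atTop (𝓝 0) :=
  tendsto_one_div_add_atTop_nhds_zero_nat

variable {E : Type*} [NormedAddCommGroup E] [NormedSpace ℝ E] [FiniteDimensional ℝ E]
  [MeasurableSpace E] [BorelSpace E]
  {E' : Type*} [NormedAddCommGroup E'] [NormedSpace ℝ E']
  {f : E → E'} {U V : Set E} {p : E} {j : ℕ}

/-- The `j`-th mollification of `f`: its convolution with the normalised `j`-th bump function of
`shrinkingBump`. -/
noncomputable def mollify (f : E → E') (j : ℕ) : E → E' :=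
  (shrinkingBump E j).normed Measure.addHaar ⋆[.lsmul ℝ ℝ, Measure.addHaar] f

theorem contDiff_mollify (hf : LocallyIntegrable f Measure.addHaar) (j : ℕ) :
    ContDiff ℝ ∞ (mollify f j) :=
  (shrinkingBump E j).hasCompactSupport_normed.contDiff_convolution_left _
    (shrinkingBump E j).contDiff_normed hf

theorem increments_mollify_subset [CompleteSpace E'] (hf : LocallyIntegrable f Measure.addHaar)
    (hV : ∀ y ∈ V, Metric.ball y (shrinkingBump E j).rOut ⊆ U) (v : E) :
    increments (mollify f j) V v ⊆ closedConvexHull ℝ (increments f U v) := by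
  set φ := shrinkingBump E j
  let ρ := φ.normed Measure.addHaar
  have hint (y : E) : Integrable (fun z => ρ z • f (y - z)) Measure.addHaar :=
    φ.hasCompactSupport_normed.convolutionExists_left (.lsmul ℝ ℝ) φ.continuous_normed hf y
  rintro _ ⟨y, hy, hyv, rfl⟩
  have hsub : mollify f j (y + v) - mollify f j y =
      ∫ z, ρ z • (f (y + v - z) - f (y - z)) ∂Measure.addHaar := by
    simp_rw [smul_sub]
    exact (integral_sub (hint _) (hint _)).symm
  rw [hsub]
  refine integral_smul_mem_of_convex convex_closedConvexHull isClosed_closedConvexHull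
    φ.continuous_normed.measurable φ.nonneg_normed φ.integral_normed
    (by simp_rw [smul_sub]; exact (hint _).sub (hint _)) fun z hz => ?_
  have hz' : ‖z‖ < φ.rOut := by simpa [ρ, φ.support_normed_eq] using hz
  rw [add_sub_right_comm]
  exact subset_closedConvexHull ⟨y - z, hV y hy (by simpa using hz'), by
    rw [← add_sub_right_comm]; exact hV _ hyv (by simpa using hz'), rfl⟩

theorem tendsto_mollify [CompleteSpace E'] (hf : LocallyIntegrable f Measure.addHaar)
    (hp : ContinuousAt f p) :
    Tendsto (fun z : ℕ × E => mollify f z.1 z.2) (atTop ×ˢ 𝓝 p) (𝓝 (f p)) :=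
  ContDiffBump.convolution_tendsto_right (g := fun _ => f)
    ((tendsto_rOut_shrinkingBump E).comp tendsto_fst)
    (.of_forall fun _ => hf.aestronglyMeasurable) (hp.tendsto.comp tendsto_snd) tendsto_snd

end Mollification

section LocalSmoothing

open MeasureTheory

variable {E : Type*} [NormedAddCommGroup E]
  {E' : Type*} [NormedAddCommGroup E'] [NormedSpace ℝ E']
  {f h m : E → E'} {U V : Set E} {χ : E → ℝ} {C Λ η : ℝ≥0} {p : E}

/-- The increment of the blend is the blend of the increments, up to an error coming from the
variation of the cutoff. -/
theorem CoerciveOn.blend (H : CoerciveOn h U C) (hVU : V ⊆ U)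
    (hm : ∀ v, increments m V v ⊆ closedConvexHull ℝ (increments h U v))
    (hχ : ∀ y, χ y ∈ Icc 0 1) (hχΛ : LipschitzOnWith Λ χ V) (hη : ∀ y ∈ V, ‖m y - h y‖ ≤ η)
    (hC : C * (Λ * η) ≤ 1 / 2) :
    CoerciveOn (fun y => h y + χ y • (m y - h y)) V (2 * C + Λ * η) := by
  refine H.of_near_closedConvexHull hC ?_
  rintro v _ ⟨y, hy, hyv, rfl⟩
  refine ⟨(1 - χ y) • (h (y + v) - h y) + χ y • (m (y + v) - m y),
    convex_closedConvexHull
      (subset_closedConvexHull (by exact ⟨y, hVU hy, hVU hyv, rfl⟩))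
      (hm v ⟨y, hy, hyv, rfl⟩) (sub_nonneg.2 (hχ y).2) (hχ y).1 (sub_add_cancel 1 _), ?_⟩
  have hΛ : ‖χ (y + v) - χ y‖ ≤ Λ * ‖v‖ := by
    simpa using hχΛ.norm_sub_le hyv hy
  calc _ = ‖(χ (y + v) - χ y) • (m (y + v) - h (y + v))‖ := by congr 1; module
    _ ≤ (Λ * ‖v‖) * η := by rw [norm_smul]; gcongr; exact hη _ hyv
    _ = (Λ * η : ℝ≥0) * ‖v‖ := by push_cast; ring

variable [NormedSpace ℝ E] [FiniteDimensional ℝ E]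

/-- `k` is a sequence of modifications of `h` inside the support of the cutoff `χ`, converging to
`h` and uniformly coercive near every point of `O`, which are smooth wherever `h` is smooth and in
the interior of `{χ = 1}`. -/
structure IsLocalSmoothing (h : E → E') (O : Set E) (χ : E → ℝ) (k : ℕ → E → E') : Prop where
  eq_of_notMem_tsupport (j : ℕ) {p : E} : p ∉ tsupport χ → k j p = h p
  continuousOn (j : ℕ) : ContinuousOn (k j) O
  tendsto {p : E} : p ∈ O → Tendsto (fun z : ℕ × E => k z.1 z.2) (atTop ×ˢ 𝓝 p) (𝓝 (h p))
  contDiffAt (j : ℕ) {p : E} : ContDiffAt ℝ ∞ h p → ContDiffAt ℝ ∞ (k j) p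
  contDiffAt_of_eventuallyEq_one (j : ℕ) {p : E} : χ =ᶠ[𝓝 p] 1 → ContDiffAt ℝ ∞ (k j) p
  coerciveOn {p : E} : p ∈ O → ∃ C, ∃ U ∈ 𝓝 p, ∀ᶠ j in atTop, CoerciveOn (k j) U C

theorem eventually_coerciveOn_blend_mollify [CompleteSpace E'] [MeasurableSpace E] [BorelSpace E]
    (hf : LocallyIntegrable f Measure.addHaar) (hfh : f =ᶠ[𝓝 p] h) (H : CoerciveAt h p)
    (hχ : ∀ y, χ y ∈ Icc 0 1) (hχs : ContDiffAt ℝ 1 χ p) :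
    ∃ C, ∃ U ∈ 𝓝 p, ∀ᶠ j in atTop,
      CoerciveOn (fun y => h y + χ y • (mollify f j y - h y)) U C := by
  have hcont := H.continuousAt
  obtain ⟨C, U, hU, H⟩ := H
  obtain ⟨Λ, W, hW, hΛ⟩ := hχs.exists_lipschitzOnWith
  obtain ⟨η, hη, hCη⟩ := exists_pos_mul_le_half (C * Λ)
  rw [mul_assoc] at hCη
  obtain ⟨s, hs, hsU⟩ := Metric.mem_nhds_iff.1 (inter_mem hU hfh)
  have hclose : ∀ᶠ z : ℕ × E in atTop ×ˢ 𝓝 p, ‖mollify f z.1 z.2 - h z.2‖ < η := by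
    have hlim : Tendsto (fun z : ℕ × E => mollify f z.1 z.2 - h z.2) (atTop ×ˢ 𝓝 p) (𝓝 0) := by
      simpa [hfh.self_of_nhds] using
        (tendsto_mollify hf (hcont.congr hfh.symm)).sub (hcont.tendsto.comp tendsto_snd)
    simpa using hlim.norm.eventually_lt_const (by simpa using hη)
  obtain ⟨P, hP, Q, hQ, hPQ⟩ := eventually_prod_iff.1 hclose
  refine ⟨2 * C + Λ * η, W ∩ {y | Q y} ∩ Metric.ball p (s / 2),
    inter_mem (inter_mem hW hQ) (Metric.ball_mem_nhds p (half_pos hs)), ?_⟩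
  filter_upwards [hP, (tendsto_rOut_shrinkingBump E).eventually_lt_const (half_pos hs)]
    with j hj hjs
  have hball : ∀ y ∈ W ∩ {y | Q y} ∩ Metric.ball p (s / 2),
      Metric.ball y (shrinkingBump E j).rOut ⊆ Metric.ball p s := fun y hy =>
    Metric.ball_subset_ball' (by linarith [Metric.mem_ball.1 hy.2])
  have hH : CoerciveOn h (Metric.ball p s) C := H.mono fun y hy => (hsU hy).1
  refine hH.blend (fun y hy => hball y hy (Metric.mem_ball_self (shrinkingBump E j).rOut_pos))
    (fun v => ?_) hχ (hΛ.mono fun y hy => hy.1.1) (fun y hy => (hPQ hj hy.1.2).le) hCη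
  rw [← increments_congr (fun y hy => (hsU hy).2) v]
  exact increments_mollify_subset hf hball v

theorem tendsto_blend_mollify [CompleteSpace E'] [MeasurableSpace E] [BorelSpace E]
    (hf : LocallyIntegrable f Measure.addHaar) (hfh : f =ᶠ[𝓝 p] h) (hp : ContinuousAt h p)
    (hχ : ContinuousAt χ p) :
    Tendsto (fun z : ℕ × E => h z.2 + χ z.2 • (mollify f z.1 z.2 - h z.2)) (atTop ×ˢ 𝓝 p)
      (𝓝 (h p)) := by
  have hh := hp.tendsto.comp (tendsto_snd (f := (atTop : Filter ℕ)))
  have hχ' := hχ.tendsto.comp (tendsto_snd (f := (atTop : Filter ℕ)))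
  simpa [hfh.self_of_nhds] using
    hh.add (hχ'.smul ((tendsto_mollify hf (hp.congr hfh.symm)).sub hh))

theorem exists_isLocalSmoothing [CompleteSpace E'] {O : Set E} (hO : IsOpen O)
    (H : ∀ p ∈ O, CoerciveAt h p) (hχ : ContDiff ℝ ∞ χ) (hχ₀₁ : ∀ y, χ y ∈ Icc 0 1)
    (hχc : HasCompactSupport χ) (hχO : tsupport χ ⊆ O) : ∃ k, IsLocalSmoothing h O χ k := by
  borelize E
  obtain ⟨L, hL, hχL, hLO⟩ := exists_compact_between hχc.isCompact hO hχO
  have hcont : ContinuousOn h O := fun p hp => (H p hp).continuousAt.continuousWithinAt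
  let f : E → E' := L.indicator h
  have hf : LocallyIntegrable f Measure.addHaar :=
    (((hcont.mono hLO).integrableOn_compact hL).integrable_indicator
      hL.measurableSet).locallyIntegrable
  have hfh {p : E} (hp : p ∈ tsupport χ) : f =ᶠ[𝓝 p] h :=
    eventually_of_mem (mem_interior_iff_mem_nhds.1 (hχL hp)) fun y hy => indicator_of_mem hy h
  have hoff (j : ℕ) {p : E} (hp : p ∉ tsupport χ) : h p + χ p • (mollify f j p - h p) = h p := by
    simp [image_eq_zero_of_notMem_tsupport hp]
  have hoff' {p : E} (hp : p ∉ tsupport χ) :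
      ∀ᶠ y in 𝓝 p, ∀ j, h y + χ y • (mollify f j y - h y) = h y := by
    filter_upwards [(isClosed_tsupport χ).isOpen_compl.mem_nhds hp] with y hy j using hoff j hy
  refine ⟨fun j y => h y + χ y • (mollify f j y - h y), hoff, fun j => ?_, fun {p} hp => ?_,
    fun j p hp => ?_, fun j p hp => ?_, fun {p} hp => ?_⟩
  · exact hcont.add (hχ.continuous.continuousOn.smul
      ((contDiff_mollify hf j).continuous.continuousOn.sub hcont))
  · by_cases hpχ : p ∈ tsupport χ
    · exact tendsto_blend_mollify hf (hfh hpχ) (H p hp).continuousAt hχ.continuous.continuousAt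
    · exact ((H p hp).continuousAt.tendsto.comp tendsto_snd).congr'
        (((hoff' hpχ).prod_inr atTop).mono fun z hz => (hz z.1).symm)
  · exact hp.add (hχ.contDiffAt.smul ((contDiff_mollify hf j).contDiffAt.sub hp))
  · refine (contDiff_mollify hf j).contDiffAt.congr_of_eventuallyEq (hp.mono fun y hy => ?_)
    simp [hy]
  · by_cases hpχ : p ∈ tsupport χ
    · exact eventually_coerciveOn_blend_mollify hf (hfh hpχ) (H p hp) hχ₀₁
        (hχ.contDiffAt.of_le (by simp))
    · obtain ⟨C, U, hU, HU⟩ := H p hp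
      exact ⟨C, _, inter_mem hU (hoff' hpχ), .of_forall fun j =>
        (HU.mono inter_subset_left).congr fun y hy => hy.2 j⟩

end LocalSmoothing

section ConvexHull

variable {V : Type*} [AddCommGroup V] [Module ℝ V] [FiniteDimensional ℝ V] {K : Set V}

open Module in
theorem convexHull_eq_biUnion_image_stdSimplex (K : Set V) :
    convexHull ℝ K = ⋃ n ≤ finrank ℝ V + 1, (fun q : (Fin n → ℝ) × (Fin n → V) =>
      ∑ i, q.1 i • q.2 i) '' (stdSimplex ℝ (Fin n) ×ˢ univ.pi fun _ => K) := by
  refine Subset.antisymm (fun x hx => ?_) (iUnion₂_subset fun n _ => ?_)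
  · obtain ⟨ι, _, z, w, hz, hind, hw, hw₁, rfl⟩ := eq_pos_convex_span_of_mem_convexHull hx
    have hcard : Fintype.card ι ≤ finrank ℝ V + 1 :=
      hind.card_le_finrank_succ.trans (Nat.succ_le_succ (Submodule.finrank_le _))
    let e := (Fintype.equivFin ι).symm
    refine mem_biUnion hcard ⟨(w ∘ e, z ∘ e), ⟨⟨fun i => (hw _).le, ?_⟩, fun i _ => ?_⟩, ?_⟩
    · exact (e.sum_comp w).trans hw₁
    · exact hz (mem_range_self _)
    · exact e.sum_comp fun i => w i • z i
  · rintro _ ⟨⟨w, z⟩, ⟨⟨hw, hw₁⟩, hz⟩, rfl⟩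
    exact (convex_convexHull ℝ K).sum_mem (fun i _ => hw i) hw₁
      fun i _ => subset_convexHull ℝ K (hz i (mem_univ i))

theorem isCompact_convexHull [TopologicalSpace V] [ContinuousAdd V] [ContinuousSMul ℝ V]
    (hK : IsCompact K) : IsCompact (convexHull ℝ K) := by
  rw [convexHull_eq_biUnion_image_stdSimplex]
  exact (finite_Iic _).isCompact_biUnion fun n _ =>
    ((isCompact_stdSimplex ℝ (Fin n)).prod (isCompact_univ_pi fun _ => hK)).image (by fun_prop)

end ConvexHull

section MeanValue

open MeasureTheory

theorem mul_sub_le_sub_of_ae_le_deriv {f : ℝ → ℝ} {a b c : ℝ} (hab : a ≤ b)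
    (hf : AbsolutelyContinuousOnInterval f a b) (hc : ∀ᵐ t, t ∈ Icc a b → c ≤ deriv f t) :
    c * (b - a) ≤ f b - f a := by
  calc c * (b - a) = ∫ _ in a..b, c := by
        rw [intervalIntegral.integral_const, smul_eq_mul, mul_comm]
    _ ≤ ∫ t in a..b, deriv f t :=
        intervalIntegral.integral_mono_ae_restrict hab intervalIntegrable_const
          hf.intervalIntegrable_deriv ((ae_restrict_iff' measurableSet_Icc).2 hc)
    _ = f b - f a := hf.integral_deriv_eq_sub

variable {E : Type*} [NormedAddCommGroup E] [NormedSpace ℝ E]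
  {E' : Type*} [NormedAddCommGroup E'] [NormedSpace ℝ E']
  {h : E → E'} {U : Set E} {L : ℝ≥0} {c : ℝ} {v y : E}

theorem le_apply_sub_of_ae_le_fderiv_line (hh : LipschitzOnWith L h U) (hUc : Convex ℝ U)
    (w : E' →L[ℝ] ℝ) (hy : y ∈ U) (hyv : y + v ∈ U)
    (hc : ∀ᵐ t : ℝ, y + t • v ∈ U →
      DifferentiableAt ℝ h (y + t • v) ∧ c ≤ w (fderiv ℝ h (y + t • v) v)) :
    c ≤ w (h (y + v) - h y) := by
  have hmem : MapsTo (fun t : ℝ => y + t • v) (Icc 0 1) U := fun t ht => by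
    simpa using hUc.add_smul_mem hy hyv ht
  have hlip : LipschitzWith ‖v‖₊ fun t : ℝ => y + t • v := LipschitzWith.of_dist_le_mul
    fun s t => by rw [dist_add_left, dist_eq_norm, ← sub_smul, norm_smul, mul_comm]; rfl
  have hac : AbsolutelyContinuousOnInterval (fun t : ℝ => w (h (y + t • v))) 0 1 := by
    refine LipschitzOnWith.absolutelyContinuousOnInterval (K := ‖w‖₊ * (L * ‖v‖₊)) ?_
    rw [uIcc_of_le zero_le_one]
    exact w.lipschitz.comp_lipschitzOnWith (hh.comp hlip.lipschitzOnWith hmem)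
  have hderiv : ∀ᵐ t : ℝ, t ∈ Icc (0 : ℝ) 1 → c ≤ deriv (fun t : ℝ => w (h (y + t • v))) t := by
    filter_upwards [hc] with t ht ht₀₁
    obtain ⟨hd, hle⟩ := ht (hmem ht₀₁)
    have hline : HasDerivAt (fun s : ℝ => y + s • v) v t := by
      simpa using ((hasDerivAt_id t).smul_const v).const_add y
    have := (w.hasFDerivAt.comp _ hd.hasFDerivAt).comp_hasDerivAt t hline
    exact hle.trans this.deriv.ge
  simpa using mul_sub_le_sub_of_ae_le_deriv zero_le_one hac hderiv

variable [FiniteDimensional ℝ E] [FiniteDimensional ℝ E']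

/- By Rademacher and Fubini, `h` is differentiable almost everywhere on almost every line of
direction `v`, where the fundamental theorem of calculus applies; `y` is a limit of points of such
lines. -/
theorem le_apply_sub_of_le_fderiv (hh : LipschitzOnWith L h U) (hU : IsOpen U)
    (hUc : Convex ℝ U) (w : E' →L[ℝ] ℝ)
    (hc : ∀ q ∈ U, DifferentiableAt ℝ h q → c ≤ w (fderiv ℝ h q v)) (hy : y ∈ U)
    (hyv : y + v ∈ U) : c ≤ w (h (y + v) - h y) := by
  borelize E
  let μ : Measure E := Measure.addHaar
  have hdiff : ∀ᵐ q ∂μ, q ∈ U → DifferentiableAt ℝ h q :=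
    hh.ae_differentiableWithinAt_of_mem.mono fun q hq hqU =>
      (hq hqU).differentiableAt (hU.mem_nhds hqU)
  obtain ⟨s, hs, hsm, hsd⟩ := hdiff.exists_measurable_mem
  have hlines : ∀ᵐ z ∂μ, ∀ᵐ t : ℝ, z + t • v ∈ s :=
    (ae_ae_add_linearMap_mem_iff (LinearMap.toSpanSingleton ℝ E v) volume μ hsm).2 hs
  have hW : {z | z ∈ U ∧ z + v ∈ U} ∈ 𝓝 y :=
    (hU.inter (hU.preimage (continuous_add_const v))).mem_nhds ⟨hy, hyv⟩
  have hcont : Tendsto (fun z => w (h (z + v) - h z)) (𝓝 y) (𝓝 (w (h (y + v) - h y))) := by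
    have hat : ∀ x ∈ U, ContinuousAt h x := fun x hx =>
      hh.continuousOn.continuousAt (hU.mem_nhds hx)
    have hshift : ContinuousAt (fun z => h (z + v)) y :=
      ContinuousAt.comp' (f := (· + v)) (hat _ hyv) (by fun_prop)
    exact (w.continuous.tendsto _).comp (hshift.sub (hat y hy))
  refine ge_of_tendsto_of_frequently hcont ?_
  have hdense : ∃ᶠ z in 𝓝 y, ∀ᵐ t : ℝ, z + t • v ∈ s :=
    mem_closure_iff_frequently.1 (Measure.dense_of_ae hlines y)
  refine (hdense.and_eventually hW).mono fun z ⟨hz, hzU, hzv⟩ => ?_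
  exact le_apply_sub_of_ae_le_fderiv_line hh hUc w hzU hzv <|
    hz.mono fun t ht htU => ⟨hsd _ ht htU, hc _ htU (hsd _ ht htU)⟩

end MeanValue

section Clarke

variable {E : Type*} [NormedAddCommGroup E] [NormedSpace ℝ E]
  {E' : Type*} [NormedAddCommGroup E'] [NormedSpace ℝ E']
  {h : E → E'} {p : E} {L : ℝ≥0} {U : Set E}

/-- The limits of derivatives of `h` along points of differentiability converging to `p`. Clarke's
generalized differential is their convex hull. Cluster points are used instead of limits of
sequences. -/
def limitFDerivs (h : E → E') (p : E) : Set (E →L[ℝ] E') :=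
  {A | MapClusterPt A (𝓝[{q | DifferentiableAt ℝ h q}] p) (fderiv ℝ h)}

theorem isClosed_limitFDerivs (h : E → E') (p : E) : IsClosed (limitFDerivs h p) :=
  isClosed_setOfPred_clusterPt

theorem eventually_fderiv_mem_closedBall (hU : U ∈ 𝓝 p) (hh : LipschitzOnWith L h U) :
    ∀ᶠ q in 𝓝 p, fderiv ℝ h q ∈ Metric.closedBall 0 (L : ℝ) := by
  filter_upwards [eventually_mem_nhds_iff.2 hU] with q hq
  exact mem_closedBall_zero_iff.2 (norm_fderiv_le_of_lipschitzOn ℝ hq hh)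

theorem exists_functional_of_le_norm {S : Set E'} (hS : Convex ℝ S) {a : ℝ} (ha : 0 < a)
    (hle : ∀ s ∈ S, a ≤ ‖s‖) : ∃ w : E' →L[ℝ] ℝ, ‖w‖ ≤ 1 ∧ ∀ s ∈ S, a ≤ w s := by
  have hdisj : Disjoint (Metric.ball 0 a) S := disjoint_left.2 fun s hsa hs =>
    (hle s hs).not_gt (mem_ball_zero_iff.1 hsa)
  obtain ⟨f, u, hball, hf⟩ := geometric_hahn_banach_open (convex_ball 0 a) Metric.isOpen_ball hS
    hdisj
  have hu : 0 < u := by simpa using hball 0 (Metric.mem_ball_self ha)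
  have hball' : Metric.ball 0 a ⊆ {x | |f x| ≤ u} := fun x hx => by
    have hx' : -x ∈ Metric.ball 0 a := by simpa using hx
    exact abs_le.2 ⟨by linarith [hball _ hx', map_neg f x], (hball x hx).le⟩
  have hclosed : Metric.closedBall 0 a ⊆ {x | |f x| ≤ u} := by
    rw [← closure_ball 0 ha.ne']
    exact closure_minimal hball' (isClosed_le f.continuous.abs continuous_const)
  have hnorm : ‖f‖ ≤ u / a := f.opNorm_bound_of_ball_bound ha u fun x hx => hclosed hx
  refine ⟨(a / u) • f, ?_, fun s hs => ?_⟩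
  · rw [norm_smul, Real.norm_of_nonneg (by positivity)]
    calc a / u * ‖f‖ ≤ a / u * (u / a) := by gcongr
      _ = 1 := by field
  · calc a = a / u * u := by field
      _ ≤ a / u * f s := by gcongr; exact hf s hs

variable [FiniteDimensional ℝ E]

theorem exists_pos_forall_mul_norm_le {S : Set (E →L[ℝ] E')} (hS : IsCompact S)
    (hinj : ∀ A ∈ S, Function.Injective A) :
    ∃ δ > 0, ∀ A ∈ S, ∀ v, δ * ‖v‖ ≤ ‖A v‖ := by
  obtain ⟨δ, hδ, hle⟩ := (hS.prod (isCompact_sphere (0 : E) 1)).exists_forall_le' (a := 0)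
    (f := fun a : (E →L[ℝ] E') × E => ‖a.1 a.2‖) (by fun_prop) fun a ha =>
      norm_pos_iff.2 <| (map_ne_zero_iff a.1 (hinj _ ha.1)).2 (ne_zero_of_mem_unit_sphere ⟨_, ha.2⟩)
  refine ⟨δ, hδ, fun A hA v => ?_⟩
  rcases eq_or_ne v 0 with rfl | hv
  · simp
  · have hunit := hle (A, ‖v‖⁻¹ • v) ⟨hA, by simp [norm_smul, hv]⟩
    simpa only [map_smul, norm_smul, norm_inv, norm_norm, ← div_eq_inv_mul,
      le_div_iff₀ (norm_pos_iff.2 hv)] using hunit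

variable [FiniteDimensional ℝ E']

theorem isCompact_limitFDerivs (hU : U ∈ 𝓝 p) (hh : LipschitzOnWith L h U) :
    IsCompact (limitFDerivs h p) :=
  (isCompact_closedBall (0 : E →L[ℝ] E') L).of_isClosed_subset (isClosed_limitFDerivs h p)
    fun _ hA => Metric.isClosed_closedBall.mem_of_mapClusterPt hA <|
      nhdsWithin_le_nhds (eventually_fderiv_mem_closedBall hU hh)

theorem eventually_fderiv_mem_thickening (hU : U ∈ 𝓝 p) (hh : LipschitzOnWith L h U) {δ : ℝ}
    (hδ : 0 < δ) :
    ∀ᶠ q in 𝓝[{q | DifferentiableAt ℝ h q}] p,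
      fderiv ℝ h q ∈ Metric.thickening δ (limitFDerivs h p) := by
  by_contra hfar
  have hfar : ∃ᶠ q in 𝓝[{q | DifferentiableAt ℝ h q}] p, fderiv ℝ h q ∈
      Metric.closedBall 0 (L : ℝ) \ Metric.thickening δ (limitFDerivs h p) :=
    ((not_eventually.1 hfar).and_eventually
      (nhdsWithin_le_nhds (eventually_fderiv_mem_closedBall hU hh))).mono fun _ h => h.symm
  obtain ⟨A, ⟨-, hA⟩, hlim⟩ := ((isCompact_closedBall (0 : E →L[ℝ] E') L).diff
    Metric.isOpen_thickening).exists_mapClusterPt_of_frequently hfar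
  exact hA (Metric.self_subset_thickening hδ _ hlim)

theorem coerciveOn_of_fderiv_mem_thickening {S : Set (E →L[ℝ] E')} (hS : Convex ℝ S) {δ : ℝ}
    (hδ : 0 < δ) (hlow : ∀ A ∈ S, ∀ v, δ * ‖v‖ ≤ ‖A v‖) (hU : IsOpen U) (hUc : Convex ℝ U)
    (hh : LipschitzOnWith L h U)
    (hnear : ∀ q ∈ U, DifferentiableAt ℝ h q → fderiv ℝ h q ∈ Metric.thickening (δ / 2) S) :
    CoerciveOn h U (max (2 / δ).toNNReal L) := fun v => by
  rcases eq_or_ne v 0 with rfl | hv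
  · refine ⟨0, by simp, ?_⟩
    rintro _ ⟨y, -, -, rfl⟩
    simp
  let ev : (E →L[ℝ] E') →L[ℝ] E' := ContinuousLinearMap.apply ℝ E' v
  obtain ⟨w, hw, hSw⟩ := exists_functional_of_le_norm (hS.linear_image ev.toLinearMap)
    (mul_pos hδ (norm_pos_iff.2 hv)) (forall_mem_image.2 fun A hA => hlow A hA v)
  have hfderiv : ∀ q ∈ U, DifferentiableAt ℝ h q → δ / 2 * ‖v‖ ≤ w (fderiv ℝ h q v) := by
    intro q hq hd
    obtain ⟨A, hA, hdist⟩ := Metric.mem_thickening_iff.1 (hnear q hq hd)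
    have hAv : δ * ‖v‖ ≤ w (A v) := hSw _ (mem_image_of_mem _ hA)
    have hclose : |w ((fderiv ℝ h q - A) v)| ≤ 1 * (δ / 2 * ‖v‖) := by
      refine w.le_of_opNorm_le_of_le hw (ContinuousLinearMap.le_of_opNorm_le _ ?_ v)
      exact (dist_eq_norm (fderiv ℝ h q) A ▸ hdist).le
    rw [sub_apply, map_sub] at hclose
    linarith [(abs_le.1 hclose).1]
  have hδ' : ((2 / δ).toNNReal : ℝ) = 2 / δ := Real.coe_toNNReal _ (by positivity)
  refine ⟨(2 / δ) • w, ?_, ?_⟩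
  · rw [NNReal.coe_max, norm_smul, Real.norm_of_nonneg (by positivity), hδ']
    exact (mul_le_of_le_one_right (by positivity) hw).trans (le_max_left _ _)
  · rintro _ ⟨y, hy, hyv, rfl⟩
    constructor
    · have := le_apply_sub_of_le_fderiv hh hU hUc w hfderiv hy hyv
      calc ‖v‖ = 2 / δ * (δ / 2 * ‖v‖) := by field
        _ ≤ 2 / δ * w (h (y + v) - h y) := by gcongr
    · calc ‖h (y + v) - h y‖ ≤ L * ‖v‖ := by simpa using hh.norm_sub_le hyv hy
        _ ≤ _ := by gcongr; exact le_max_right _ _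

theorem coerciveAt_of_forall_injective (hU : U ∈ 𝓝 p) (hh : LipschitzOnWith L h U)
    (hinj : ∀ A ∈ convexHull ℝ (limitFDerivs h p), Function.Injective A) : CoerciveAt h p := by
  obtain ⟨δ, hδ, hlow⟩ :=
    exists_pos_forall_mul_norm_le (isCompact_convexHull (isCompact_limitFDerivs hU hh)) hinj
  have hnear := eventually_nhdsWithin_iff.1 (eventually_fderiv_mem_thickening hU hh (half_pos hδ))
  obtain ⟨r, hr, hball⟩ := Metric.mem_nhds_iff.1 (inter_mem hU hnear)
  refine ⟨_, _, Metric.ball_mem_nhds p hr, coerciveOn_of_fderiv_mem_thickening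
    (convex_convexHull ℝ _) hδ hlow Metric.isOpen_ball (convex_ball p r)
    (hh.mono fun q hq => (hball hq).1) fun q hq hd => ?_⟩
  exact Metric.thickening_subset_of_subset _ (subset_convexHull ℝ _) ((hball hq).2 hd)

end Clarke

section PathLength

open MeasureTheory Manifold

variable {E : Type*} [NormedAddCommGroup E] [NormedSpace ℝ E]
  {H : Type*} [TopologicalSpace H] {I : ModelWithCorners ℝ E H}
  {M : Type*} [TopologicalSpace M] [ChartedSpace H M] [∀ x : M, ENorm (TangentSpace I x)]
  {E' : Type*} [NormedAddCommGroup E'] [NormedSpace ℝ E']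
  {H' : Type*} [TopologicalSpace H'] {J : ModelWithCorners ℝ E' H'}
  {N : Type*} [TopologicalSpace N] [ChartedSpace H' N] [∀ y : N, ENorm (TangentSpace J y)]

theorem pathELength_comp_le {f : M → N} {s : Set M} {γ : ℝ → M} {a b : ℝ} {C : ℝ≥0}
    (hγ : MDiff[Icc a b] γ) (hmaps : MapsTo γ (Icc a b) s)
    (hf : ∀ t ∈ Icc a b, MDiffAt[s] f (γ t))
    (hC : ∀ t ∈ Icc a b, ∀ v : TangentSpace I (γ t), ‖mfderiv[s] f (γ t) v‖ₑ ≤ C * ‖v‖ₑ) :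
    pathELength J (f ∘ γ) a b ≤ C * pathELength I γ a b := by
  rcases le_or_gt b a with hba | hab
  · rw [pathELength_eq_lintegral_mfderiv_Ioo, Ioo_eq_empty hba.not_gt]
    simp
  simp only [pathELength_eq_lintegral_mfderivWithin_Icc]
  rw [← lintegral_const_mul' _ _ ENNReal.coe_ne_top]
  refine setLIntegral_mono' measurableSet_Icc fun t ht => ?_
  have huniq : UniqueMDiffWithinAt 𝓘(ℝ, ℝ) (Icc a b) t :=
    (uniqueDiffOn_Icc hab t ht).uniqueMDiffWithinAt
  rw [mfderivWithin_comp t (hf t ht) (hγ t ht) hmaps huniq]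
  exact hC t ht _

end PathLength

section ChartDistance

open MeasureTheory Manifold Bundle

attribute [local instance] normedAddCommGroupTangentSpaceVectorSpace
  normedSpaceTangentSpaceVectorSpace

variable {E : Type*} [NormedAddCommGroup E] [NormedSpace ℝ E]

theorem pathELength_lineMap (x y : E) :
    pathELength 𝓘(ℝ, E) (ContinuousAffineMap.lineMap (R := ℝ) x y) 0 1 = edist x y := by
  rw [pathELength_eq_lintegral_mfderivWithin_Icc, ← lintegral_fderiv_lineMap_eq_edist]
  simp only [mfderivWithin_eq_fderivWithin]
  rfl

theorem edist_le_pathELength {γ : ℝ → E} (hγ : ContDiffOn ℝ 1 γ (Icc 0 1)) :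
    edist (γ 0) (γ 1) ≤ pathELength 𝓘(ℝ, E) γ 0 1 := by
  rw [edist_comm, edist_eq_enorm_sub, pathELength_eq_lintegral_mfderivWithin_Icc]
  simp only [mfderivWithin_eq_fderivWithin]
  exact enorm_sub_le_lintegral_derivWithin_Icc_of_contDiffOn_Icc hγ zero_le_one

variable {E' : Type*} [NormedAddCommGroup E'] [NormedSpace ℝ E']
  {H : Type*} [TopologicalSpace H] {I : ModelWithCorners ℝ E H}
  {M : Type*} [PseudoEMetricSpace M] [ChartedSpace H M]
  [RiemannianBundle (fun x : M => TangentSpace I x)] [IsRiemannianManifold I M]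

theorem lipschitzOnWith_of_enorm_mfderivWithin_le {g : E' → M} {s u : Set E'} {C : ℝ≥0}
    (hs : Convex ℝ s) (hsu : s ⊆ u) (hg : CMDiff[s] 1 g) (hgu : ∀ q ∈ s, MDiffAt[u] g q)
    (hC : ∀ q ∈ s, ∀ v : TangentSpace 𝓘(ℝ, E') q, ‖mfderiv[u] g q v‖ₑ ≤ C * ‖v‖ₑ) :
    LipschitzOnWith C g s := by
  intro p hp q hq
  let η := ContinuousAffineMap.lineMap (R := ℝ) p q
  have hηs : MapsTo η (Icc 0 1) s := by
    rw [mapsTo_iff_image_subset, ContinuousAffineMap.coe_lineMap_eq, ← segment_eq_image_lineMap]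
    exact hs.segment_subset hp hq
  have hη : CMDiff[Icc 0 1] 1 η := (contMDiff_iff_contDiff.2 η.contDiff).contMDiffOn
  have hη₀ : η 0 = p := by simp [η, ContinuousAffineMap.coe_lineMap_eq]
  have hη₁ : η 1 = q := by simp [η, ContinuousAffineMap.coe_lineMap_eq]
  calc edist (g p) (g q) = riemannianEDist I (g p) (g q) := IsRiemannianManifold.out _ _
    _ ≤ pathELength I (g ∘ η) 0 1 :=
      riemannianEDist_le_pathELength (hg.comp hη hηs) (congrArg g hη₀) (congrArg g hη₁) zero_le_one
    _ ≤ C * pathELength 𝓘(ℝ, E') η 0 1 :=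
      pathELength_comp_le (hη.mdifferentiableOn one_ne_zero) (hηs.mono_right hsu)
        (fun t ht => hgu _ (hηs ht)) fun t ht => hC _ (hηs ht)
    _ = C * edist p q := by rw [pathELength_lineMap]

theorem exists_pathELength_lt_of_edist_add_lt {x y z : M} {ε r : ENNReal}
    (hε : edist x y + edist y z < ε) (hr : edist y z < r) :
    ∃ γ : ℝ → M, γ 0 = y ∧ γ 1 = z ∧ CMDiff[Icc 0 1] 1 γ ∧
      MapsTo γ (Icc 0 1) (Metric.eball x ε) ∧ pathELength I γ 0 1 < r := by
  have hlt : riemannianEDist I y z < min r (ε - edist x y) := by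
    rw [← IsRiemannianManifold.out (I := I)]
    exact lt_min hr (lt_tsub_iff_left.2 hε)
  obtain ⟨γ, hγy, hγz, hγ, hlen⟩ := exists_lt_of_riemannianEDist_lt hlt
  refine ⟨γ, hγy, hγz, hγ, fun t ht => ?_, hlen.trans_le (min_le_left _ _)⟩
  have hyt : edist y (γ t) < ε - edist x y :=
    calc edist y (γ t) = riemannianEDist I y (γ t) := IsRiemannianManifold.out _ _
      _ ≤ pathELength I γ 0 t :=
        riemannianEDist_le_pathELength (hγ.mono (Icc_subset_Icc_right ht.2)) hγy rfl ht.1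
      _ ≤ pathELength I γ 0 1 := pathELength_mono le_rfl ht.2
      _ < ε - edist x y := hlen.trans_le (min_le_right _ _)
  rw [Metric.mem_eball']
  exact (edist_triangle _ _ _).trans_lt (lt_tsub_iff_left.1 hyt)

theorem edist_le_mul_edist_of_enorm_mfderiv_le {f : M → E'} {x y z : M} {ε : ENNReal} {C : ℝ≥0}
    (hf : CMDiff[Metric.eball x ε] 1 f)
    (hC : ∀ w ∈ Metric.eball x ε, ∀ v : TangentSpace I w, ‖mfderiv% f w v‖ₑ ≤ C * ‖v‖ₑ)
    (hε : edist x y + edist y z < ε) : edist (f y) (f z) ≤ C * edist y z := by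
  have hyz : edist y z ≠ ⊤ := ((le_add_self.trans_lt hε).trans_le le_top).ne
  rw [mul_comm, ← ENNReal.div_le_iff_le_mul (.inr hyz) (.inl ENNReal.coe_ne_top)]
  refine le_of_forall_gt_imp_ge_of_dense fun r hr => ?_
  refine ENNReal.div_le_of_le_mul' ?_
  obtain ⟨γ, rfl, rfl, hγ, hmaps, hlen⟩ := exists_pathELength_lt_of_edist_add_lt (I := I) hε hr
  calc edist (f (γ 0)) (f (γ 1)) ≤ pathELength 𝓘(ℝ, E') (f ∘ γ) 0 1 :=
        edist_le_pathELength (contMDiffOn_iff_contDiffOn.1 (hf.comp hγ hmaps))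
    _ ≤ C * pathELength I γ 0 1 := by
      refine pathELength_comp_le (hγ.mdifferentiableOn one_ne_zero) hmaps
        (fun t ht => hf.mdifferentiableOn one_ne_zero _ (hmaps ht)) fun t ht => ?_
      rw [mfderivWithin_of_isOpen Metric.isOpen_eball (hmaps ht)]
      exact hC _ (hmaps ht)
    _ ≤ C * r := by gcongr

variable (I) [IsManifold I 1 M] [IsContinuousRiemannianBundle E (fun x : M => TangentSpace I x)]

theorem exists_lipschitzOnWith_extChartAt_symm (x : M) :
    ∃ C : ℝ≥0, ∃ U ∈ 𝓝[range I] (extChartAt I x x), LipschitzOnWith C (extChartAt I x).symm U := by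
  obtain ⟨C, -, hC⟩ := eventually_enorm_mfderivWithin_symm_extChartAt_lt I x
  obtain ⟨r, hr, hball⟩ :=
    Metric.mem_nhdsWithin_iff.1 (inter_mem (extChartAt_target_mem_nhdsWithin x) hC)
  refine ⟨C, _, inter_mem_nhdsWithin _ (Metric.ball_mem_nhds _ hr), ?_⟩
  rw [inter_comm]
  refine lipschitzOnWith_of_enorm_mfderivWithin_le ((convex_ball _ _).inter I.convex_range)
    inter_subset_right ((contMDiffOn_extChartAt_symm x).mono fun q hq => (hball hq).1)
    (fun q hq => mdifferentiableWithinAt_extChartAt_symm (hball hq).1) fun q hq v => ?_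
  exact (ContinuousLinearMap.le_opENorm _ v).trans (by gcongr; exact (hball hq).2.le)

theorem exists_lipschitzOnWith_extChartAt (x : M) :
    ∃ C : ℝ≥0, ∃ V ∈ 𝓝 x, LipschitzOnWith C (extChartAt I x) V := by
  obtain ⟨C, -, hC⟩ := eventually_enorm_mfderiv_extChartAt_lt I x
  obtain ⟨ε, hε, hball⟩ := EMetric.mem_nhds_iff.1 (inter_mem (chart_source_mem_nhds H x) hC)
  have hε3 : 0 < ε / 3 := ENNReal.div_pos hε.ne' (by simp)
  refine ⟨C, _, Metric.eball_mem_nhds x hε3, fun y hy z hz => ?_⟩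
  refine edist_le_mul_edist_of_enorm_mfderiv_le (x := x) (ε := ε)
    (contMDiffOn_extChartAt.mono fun w hw => (hball hw).1) (fun w hw v => ?_) ?_
  · exact (ContinuousLinearMap.le_opENorm _ v).trans (by gcongr; exact (hball hw).2.le)
  · rw [Metric.mem_eball'] at hy hz
    calc edist x y + edist y z ≤ edist x y + (edist x y + edist x z) := by
          gcongr
          exact edist_triangle_left y z x
      _ < ε / 3 + (ε / 3 + ε / 3) := ENNReal.add_lt_add hy (ENNReal.add_lt_add hy hz)
      _ = ε := by rw [← add_assoc, ENNReal.add_thirds]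

end ChartDistance

section LipschitzCharts

variable {E : Type*} [NormedAddCommGroup E] [NormedSpace ℝ E]
  {M : Type*} [PseudoEMetricSpace M] [ChartedSpace E M] [IsManifold 𝓘(ℝ, E) 1 M]
  [Bundle.RiemannianBundle (fun x : M => TangentSpace 𝓘(ℝ, E) x)]
  [IsContinuousRiemannianBundle E (fun x : M => TangentSpace 𝓘(ℝ, E) x)]
  [IsRiemannianManifold 𝓘(ℝ, E) M]
  {E' : Type*} [NormedAddCommGroup E'] [NormedSpace ℝ E']
  {N : Type*} [PseudoEMetricSpace N] [ChartedSpace E' N] [IsManifold 𝓘(ℝ, E') 1 N]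
  [Bundle.RiemannianBundle (fun y : N => TangentSpace 𝓘(ℝ, E') y)]
  [IsContinuousRiemannianBundle E' (fun y : N => TangentSpace 𝓘(ℝ, E') y)]
  [IsRiemannianManifold 𝓘(ℝ, E') N]

theorem exists_lipschitzOnWith_chartAt_comp {F : M → N} {K : ℝ≥0} (hF : LipschitzWith K F)
    (x : M) : ∃ L : ℝ≥0, ∃ U ∈ 𝓝 (chartAt E x x),
      LipschitzOnWith L (chartAt E' (F x) ∘ F ∘ (chartAt E x).symm) U := by
  obtain ⟨C₁, U, hU, hC₁⟩ := exists_lipschitzOnWith_extChartAt_symm 𝓘(ℝ, E) x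
  obtain ⟨C₂, V, hV, hC₂⟩ := exists_lipschitzOnWith_extChartAt 𝓘(ℝ, E') (F x)
  simp only [modelWithCornersSelf_coe, range_id, nhdsWithin_univ, mfld_simps] at hU hC₁ hC₂
  refine ⟨C₂ * (K * C₁), U ∩ (F ∘ (chartAt E x).symm) ⁻¹' V, inter_mem hU ?_,
    hC₂.comp (hF.comp_lipschitzOnWith (hC₁.mono inter_subset_left)) inter_subset_right⟩
  have hcont : ContinuousAt (chartAt E x).symm (chartAt E x x) :=
    (chartAt E x).continuousAt_symm (mem_chart_target E x)
  refine (hF.continuous.continuousAt.comp hcont).preimage_mem_nhds ?_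
  rwa [Function.comp_apply, (chartAt E x).left_inv (mem_chart_source E x)]

theorem finrank_le_of_lipschitzOnWith_of_image_mem_nhds [FiniteDimensional ℝ E]
    [FiniteDimensional ℝ E'] {h : E → E'} {U : Set E} {p : E} {q : E'} {L : ℝ≥0}
    (hh : LipschitzOnWith L h U) (hU : U ∈ 𝓝 p) (hhU : h '' U ∈ 𝓝 q) :
    Module.finrank ℝ E' ≤ Module.finrank ℝ E := by
  have hdim := hh.dimH_image_le
  rw [Real.dimH_of_mem_nhds hhU, Real.dimH_of_mem_nhds hU] at hdim
  exact_mod_cast hdim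

theorem finrank_le_of_lipschitzWith_homeomorph [FiniteDimensional ℝ E] [FiniteDimensional ℝ E']
    (F : M ≃ₜ N) {K : ℝ≥0} (hF : LipschitzWith K F) (x : M) :
    Module.finrank ℝ E' ≤ Module.finrank ℝ E := by
  obtain ⟨L, U, hU, hL⟩ := exists_lipschitzOnWith_chartAt_comp (E := E) (E' := E') hF x
  let T : OpenPartialHomeomorph E E' :=
    (chartAt E x).symm ≫ₕ F.toOpenPartialHomeomorph ≫ₕ chartAt E' (F x)
  have hT : chartAt E x x ∈ T.source := by simp [T]
  refine finrank_le_of_lipschitzOnWith_of_image_mem_nhds (h := T) (q := T (chartAt E x x)) hL hU ?_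
  rw [← T.map_nhds_eq hT]
  exact image_mem_map hU

end LipschitzCharts

section CompactConvergence

variable {ι X Y : Type*} [TopologicalSpace X] [TopologicalSpace Y] {l : Filter ι}

theorem eventually_forall_mem_of_isCompact {K : Set X} (hK : IsCompact K) {P : ι → X → Prop}
    (h : ∀ x ∈ K, ∀ᶠ z : ι × X in l ×ˢ 𝓝 x, P z.1 z.2) : ∀ᶠ i in l, ∀ x ∈ K, P i x := by
  obtain ⟨pa, ha, pb, hb, hab⟩ := eventually_prod_iff.1 (hK.mem_prod_nhdsSet_of_forall h)
  exact ha.mono fun i hi x hx => hab hi (subset_of_mem_nhdsSet hb hx)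

theorem tendsto_continuousMap_of_forall_tendsto_prod {g : ι → C(X, Y)} {f : C(X, Y)}
    (h : ∀ x, Tendsto (fun z : ι × X => g z.1 z.2) (l ×ˢ 𝓝 x) (𝓝 (f x))) :
    Tendsto g l (𝓝 f) := by
  rw [ContinuousMap.tendsto_nhds_compactOpen]
  intro K hK U hU hfU
  exact eventually_forall_mem_of_isCompact hK fun x hx => h x (hU.mem_nhds (hfU hx))

theorem exists_tendsto_continuousMap {g : ι → X → Y} {f : C(X, Y)}
    (hg : ∀ᶠ i in l, Continuous (g i))
    (h : ∀ x, Tendsto (fun z : ι × X => g z.1 z.2) (l ×ˢ 𝓝 x) (𝓝 (f x))) :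
    ∃ G : ι → C(X, Y), (∀ᶠ i in l, ⇑(G i) = g i) ∧ Tendsto G l (𝓝 f) := by
  classical
  let G (i : ι) : C(X, Y) := if hc : Continuous (g i) then ⟨g i, hc⟩ else f
  have hG : ∀ᶠ i in l, ⇑(G i) = g i := hg.mono fun i hc => by simp [G, hc]
  refine ⟨G, hG, tendsto_continuousMap_of_forall_tendsto_prod fun x => (h x).congr' ?_⟩
  filter_upwards [hG.prod_inl (𝓝 x)] with z hz
  rw [hz]

theorem eventually_injective_of_forall_tendsto_prod [CompactSpace X] [T2Space Y] {g : ι → X → Y}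
    {f : X → Y} (hf : Function.Injective f)
    (h : ∀ x, Tendsto (fun z : ι × X => g z.1 z.2) (l ×ˢ 𝓝 x) (𝓝 (f x)))
    (hloc : ∀ x, ∃ U ∈ 𝓝 x, ∀ᶠ i in l, InjOn (g i) U) : ∀ᶠ i in l, Function.Injective (g i) := by
  suffices hpair : ∀ᶠ i in l, ∀ p ∈ (univ : Set (X × X)), g i p.1 = g i p.2 → p.1 = p.2 from
    hpair.mono fun i hi x y hxy => hi (x, y) (mem_univ _) hxy
  refine eventually_forall_mem_of_isCompact isCompact_univ fun ⟨x, y⟩ _ => ?_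
  rw [nhds_prod_eq]
  rcases eq_or_ne x y with rfl | hxy
  · obtain ⟨U, hU, hinj⟩ := hloc x
    filter_upwards [hinj.prod_mk (prod_mem_prod hU hU)] with z hz hzz
    exact hz.1 hz.2.1 hz.2.2 hzz
  · obtain ⟨u, v, hu, hv, hxu, hyv, huv⟩ := t2_separation (hf.ne hxy)
    have hx : Tendsto (fun z : ι × X × X => (z.1, z.2.1)) (l ×ˢ (𝓝 x ×ˢ 𝓝 y)) (l ×ˢ 𝓝 x) :=
      tendsto_fst.prodMk (tendsto_fst.comp tendsto_snd)
    have hy : Tendsto (fun z : ι × X × X => (z.1, z.2.2)) (l ×ˢ (𝓝 x ×ˢ 𝓝 y)) (l ×ˢ 𝓝 y) :=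
      tendsto_fst.prodMk (tendsto_snd.comp tendsto_snd)
    filter_upwards [hx.eventually ((h x).eventually (hu.mem_nhds hxu)),
      hy.eventually ((h y).eventually (hv.mem_nhds hyv))] with z hzu hzv hzz
    exact absurd hzz (huv.ne_of_mem hzu hzv)

end CompactConvergence

section ManifoldCoercivity

variable {E : Type*} [NormedAddCommGroup E]
  {M : Type*} [TopologicalSpace M] [ChartedSpace E M]
  {E' : Type*} [NormedAddCommGroup E'] [NormedSpace ℝ E']
  {N : Type*} [TopologicalSpace N] [ChartedSpace E' N]

variable (E E') in
/-- Coercivity at `x` of a map between manifolds, for the expression of the map in the preferred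
charts at `x` and `f x`; other charts give the same notion, see `mCoerciveAt_iff`. -/
def MCoerciveAt (f : M → N) (x : M) : Prop :=
  CoerciveAt (chartAt E' (f x) ∘ f ∘ (chartAt E x).symm) (chartAt E x x)

theorem MCoerciveAt.congr {f g : M → N} {x : M} (H : MCoerciveAt E E' f x) (hg : g =ᶠ[𝓝 x] f) :
    MCoerciveAt E E' g x := by
  rw [MCoerciveAt, hg.eq_of_nhds]
  refine CoerciveAt.congr H (((chartAt E x).eventually_nhds _ (mem_chart_source E x)).2 ?_)
  filter_upwards [hg, (chartAt E x).open_source.mem_nhds (mem_chart_source E x)] with y hy hyx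
  simp [hyx, hy]

variable [NormedSpace ℝ E]

theorem exists_hasStrictFDerivAt_coordChange [IsManifold 𝓘(ℝ, E) 1 M] {a b x : M}
    (ha : x ∈ (chartAt E a).source) (hb : x ∈ (chartAt E b).source) :
    ∃ B : E ≃L[ℝ] E, HasStrictFDerivAt (chartAt E b ∘ (chartAt E a).symm) (B : E →L[ℝ] E)
      (chartAt E a x) := by
  rw [← extChartAt_source 𝓘(ℝ, E)] at ha hb
  have hinv {c d : M} (hc : x ∈ (extChartAt 𝓘(ℝ, E) c).source)
      (hd : x ∈ (extChartAt 𝓘(ℝ, E) d).source) :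
      Function.LeftInverse (tangentCoordChange 𝓘(ℝ, E) d c x)
        (tangentCoordChange 𝓘(ℝ, E) c d x) := fun v => by
    rw [tangentCoordChange_comp ⟨⟨hc, hd⟩, hc⟩, tangentCoordChange_self hc]
  have hderiv := hasFDerivWithinAt_tangentCoordChange ⟨ha, hb⟩
  have hsmooth : ContDiffWithinAt ℝ 1 (extChartAt 𝓘(ℝ, E) b ∘ (extChartAt 𝓘(ℝ, E) a).symm)
      (range 𝓘(ℝ, E)) (extChartAt 𝓘(ℝ, E) a x) :=
    contDiffWithinAt_ext_coord_change b a (by simp_all)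
  simp only [mfld_simps, hasFDerivWithinAt_univ, contDiffWithinAt_univ] at hderiv hsmooth
  exact ⟨.equivOfInverse _ _ (hinv ha hb) (hinv hb ha),
    hsmooth.hasStrictFDerivAt' hderiv one_ne_zero⟩

theorem CoerciveAt.of_chart_change [IsManifold 𝓘(ℝ, E) 1 M] [IsManifold 𝓘(ℝ, E') 1 N]
    {f : M → N} {x : M} (hf : ContinuousAt f x) {a a' : M} {b b' : N}
    (ha : x ∈ (chartAt E a).source) (ha' : x ∈ (chartAt E a').source)
    (hb : f x ∈ (chartAt E' b).source) (hb' : f x ∈ (chartAt E' b').source)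
    (H : CoerciveAt (chartAt E' b ∘ f ∘ (chartAt E a).symm) (chartAt E a x)) :
    CoerciveAt (chartAt E' b' ∘ f ∘ (chartAt E a').symm) (chartAt E a' x) := by
  obtain ⟨A, hA⟩ := exists_hasStrictFDerivAt_coordChange ha' ha
  obtain ⟨B, hB⟩ := exists_hasStrictFDerivAt_coordChange hb hb'
  have hleft : CoerciveAt ((chartAt E' b' ∘ (chartAt E' b).symm) ∘
      (chartAt E' b ∘ f ∘ (chartAt E a).symm)) (chartAt E a x) :=
    H.comp_left (by simpa [ha] using hB)
  have hright := CoerciveAt.comp_right (φ := chartAt E a ∘ (chartAt E a').symm)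
    (by simpa [ha'] using hleft) hA
  refine hright.congr (((chartAt E a').eventually_nhds _ ha').2 ?_)
  filter_upwards [(chartAt E a').open_source.mem_nhds ha', (chartAt E a).open_source.mem_nhds ha,
    hf ((chartAt E' b).open_source.mem_nhds hb)] with y hya' hya hyb
  simp_all

theorem mCoerciveAt_iff [IsManifold 𝓘(ℝ, E) 1 M] [IsManifold 𝓘(ℝ, E') 1 N]
    {f : M → N} {x : M} (hf : ContinuousAt f x) {a : M} {b : N}
    (ha : x ∈ (chartAt E a).source) (hb : f x ∈ (chartAt E' b).source) :
    MCoerciveAt E E' f x ↔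
      CoerciveAt (chartAt E' b ∘ f ∘ (chartAt E a).symm) (chartAt E a x) :=
  ⟨.of_chart_change hf (mem_chart_source E x) ha (mem_chart_source E' (f x)) hb,
    .of_chart_change hf ha (mem_chart_source E x) hb (mem_chart_source E' (f x))⟩

theorem contMDiffAt_iff_contDiffAt_chartAt [IsManifold 𝓘(ℝ, E) ∞ M] [IsManifold 𝓘(ℝ, E') ∞ N]
    {f : M → N} {x : M} (hf : ContinuousAt f x) {a : M} {b : N}
    (ha : x ∈ (chartAt E a).source) (hb : f x ∈ (chartAt E' b).source) :
    ContMDiffAt 𝓘(ℝ, E) 𝓘(ℝ, E') ∞ f x ↔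
      ContDiffAt ℝ ∞ (chartAt E' b ∘ f ∘ (chartAt E a).symm) (chartAt E a x) := by
  rw [contMDiffAt_iff_of_mem_source ha hb, and_iff_right hf]
  simp only [mfld_simps, contDiffWithinAt_univ]

end ManifoldCoercivity

section ChartPatch

variable {X Y M N : Type*} [TopologicalSpace X] [TopologicalSpace Y] [TopologicalSpace M]
  [TopologicalSpace N]

/-- The open set on which the expression `ψ ∘ f ∘ φ.symm` of `f` in the charts `φ` and `ψ` is
meaningful. -/
def chartDomain (φ : OpenPartialHomeomorph M X) (ψ : OpenPartialHomeomorph N Y) (f : M → N) :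
    Set X :=
  φ.target ∩ φ.symm ⁻¹' (f ⁻¹' ψ.source)

open Classical in
/-- The map `f` with its expression in the charts `φ` and `ψ` replaced by `k` over the set `S`. -/
noncomputable def chartPatch (φ : OpenPartialHomeomorph M X) (ψ : OpenPartialHomeomorph N Y)
    (S : Set X) (f : M → N) (k : X → Y) : M → N :=
  (φ.symm '' S).piecewise (ψ.symm ∘ k ∘ φ) f

/-- `k` is a modification over `S` of the expression of `f` in the charts `φ` and `ψ`, of the kind
that patches with `f` to a continuous map `chartPatch φ ψ S f k`. -/
structure IsChartModification (φ : OpenPartialHomeomorph M X) (ψ : OpenPartialHomeomorph N Y)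
    (S : Set X) (f : M → N) (k : X → Y) : Prop where
  isClosed_image_symm : IsClosed (φ.symm '' S)
  subset_chartDomain : S ⊆ chartDomain φ ψ f
  eq_of_notMem {p : X} : p ∉ S → k p = ψ (f (φ.symm p))
  mapsTo : MapsTo k S ψ.target
  continuousOn : ContinuousOn k (chartDomain φ ψ f)

variable {φ : OpenPartialHomeomorph M X} {ψ : OpenPartialHomeomorph N Y} {S : Set X} {f : M → N}
  {k : X → Y} {x : M}

theorem isOpen_chartDomain (hf : Continuous f) : IsOpen (chartDomain φ ψ f) :=
  φ.isOpen_inter_preimage_symm (ψ.open_source.preimage hf)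

theorem map_mem_chartDomain (hx : x ∈ φ.source) (hfx : f x ∈ ψ.source) :
    φ x ∈ chartDomain φ ψ f :=
  ⟨φ.map_source hx, by simpa [hx] using hfx⟩

theorem chartPatch_of_notMem (hx : x ∉ φ.symm '' S) : chartPatch φ ψ S f k x = f x := by
  classical exact piecewise_eq_of_notMem _ _ _ hx

namespace IsChartModification

theorem mem_source_or_notMem_image_symm (H : IsChartModification φ ψ S f k) (x : M) :
    (x ∈ φ.source ∧ f x ∈ ψ.source) ∨ x ∉ φ.symm '' S := by
  refine or_not_of_imp ?_
  rintro ⟨p, hp, rfl⟩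
  exact ⟨φ.map_target (H.subset_chartDomain hp).1, (H.subset_chartDomain hp).2⟩

theorem eventually_notMem_image_symm (H : IsChartModification φ ψ S f k) (hx : x ∉ φ.symm '' S) :
    ∀ᶠ y in 𝓝 x, y ∉ φ.symm '' S :=
  H.isClosed_image_symm.isOpen_compl.eventually_mem hx

theorem chartPatch_eventuallyEq (H : IsChartModification φ ψ S f k) (hx : x ∉ φ.symm '' S) :
    chartPatch φ ψ S f k =ᶠ[𝓝 x] f :=
  (H.eventually_notMem_image_symm hx).mono fun _ => chartPatch_of_notMem

theorem mapsTo_chartDomain (H : IsChartModification φ ψ S f k) :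
    MapsTo k (chartDomain φ ψ f) ψ.target := by
  intro p hp
  by_cases hpS : p ∈ S
  · exact H.mapsTo hpS
  · rw [H.eq_of_notMem hpS]
    exact ψ.map_source hp.2

theorem chartPatch_of_mem_source (H : IsChartModification φ ψ S f k) (hx : x ∈ φ.source)
    (hfx : f x ∈ ψ.source) : chartPatch φ ψ S f k x = ψ.symm (k (φ x)) := by
  by_cases hxS : x ∈ φ.symm '' S
  · classical exact piecewise_eq_of_mem _ _ _ hxS
  · have hφx : φ x ∉ S := fun h => hxS ⟨φ x, h, φ.left_inv hx⟩
    rw [chartPatch_of_notMem hxS, H.eq_of_notMem hφx, φ.left_inv hx, ψ.left_inv hfx]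

theorem chartPatch_mem_source (H : IsChartModification φ ψ S f k) (hx : x ∈ φ.source)
    (hfx : f x ∈ ψ.source) : chartPatch φ ψ S f k x ∈ ψ.source := by
  rw [H.chartPatch_of_mem_source hx hfx]
  exact ψ.map_target (H.mapsTo_chartDomain (map_mem_chartDomain hx hfx))

theorem eqOn_chartPatch (H : IsChartModification φ ψ S f k) :
    EqOn (ψ ∘ chartPatch φ ψ S f k ∘ φ.symm) k (chartDomain φ ψ f) := fun p hp => by
  simp only [Function.comp_apply]
  rw [H.chartPatch_of_mem_source (φ.map_target hp.1) hp.2, φ.right_inv hp.1,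
    ψ.right_inv (H.mapsTo_chartDomain hp)]

theorem chart_comp_chartPatch_eventuallyEq (H : IsChartModification φ ψ S f k) (hf : Continuous f)
    (hx : x ∈ φ.source) (hfx : f x ∈ ψ.source) :
    ψ ∘ chartPatch φ ψ S f k ∘ φ.symm =ᶠ[𝓝 (φ x)] k :=
  H.eqOn_chartPatch.eventuallyEq_of_mem
    ((isOpen_chartDomain hf).mem_nhds (map_mem_chartDomain hx hfx))

theorem continuous_chartPatch (H : IsChartModification φ ψ S f k) (hf : Continuous f) :
    Continuous (chartPatch φ ψ S f k) := by
  refine continuous_iff_continuousAt.2 fun x => ?_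
  rcases H.mem_source_or_notMem_image_symm x with ⟨hx, hfx⟩ | hx
  · have hφx := map_mem_chartDomain hx hfx
    have hkφ : ContinuousAt (k ∘ φ) x :=
      (H.continuousOn.continuousAt ((isOpen_chartDomain hf).mem_nhds hφx)).comp
        (φ.continuousAt hx)
    have hcont : ContinuousAt (ψ.symm ∘ k ∘ φ) x :=
      (ψ.continuousAt_symm (H.mapsTo_chartDomain hφx)).comp (f := k ∘ φ) hkφ
    refine hcont.congr ?_
    filter_upwards [φ.open_source.mem_nhds hx, hf.continuousAt (ψ.open_source.mem_nhds hfx)]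
      with y hy hfy using (H.chartPatch_of_mem_source hy hfy).symm
  · exact hf.continuousAt.congr (H.chartPatch_eventuallyEq hx).symm

variable {ι : Type*} {l : Filter ι} [l.NeBot] {k : ι → X → Y}

theorem tendsto_chartPatch (H : ∀ᶠ i in l, IsChartModification φ ψ S f (k i)) (hf : Continuous f)
    (hlim : ∀ p ∈ chartDomain φ ψ f,
      Tendsto (fun z : ι × X => k z.1 z.2) (l ×ˢ 𝓝 p) (𝓝 (ψ (f (φ.symm p))))) (x : M) :
    Tendsto (fun z : ι × M => chartPatch φ ψ S f (k z.1) z.2) (l ×ˢ 𝓝 x) (𝓝 (f x)) := by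
  obtain ⟨i, hi⟩ := H.exists
  rcases hi.mem_source_or_notMem_image_symm x with ⟨hx, hfx⟩ | hx
  · have hk_lim : Tendsto (fun z : ι × M => k z.1 (φ z.2)) (l ×ˢ 𝓝 x) (𝓝 (ψ (f x))) := by
      have hφx := hlim _ (map_mem_chartDomain hx hfx)
      rw [φ.left_inv hx] at hφx
      exact hφx.comp (tendsto_fst.prodMk ((φ.continuousAt hx).tendsto.comp tendsto_snd))
    have hψk_lim := (ψ.continuousAt_symm (ψ.map_source hfx)).tendsto.comp hk_lim
    rw [ψ.left_inv hfx] at hψk_lim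
    have hnhds : ∀ᶠ y in 𝓝 x, y ∈ φ.source ∧ f y ∈ ψ.source :=
      (φ.open_source.eventually_mem hx).and
        (hf.continuousAt.eventually (ψ.open_source.eventually_mem hfx))
    refine hψk_lim.congr' ?_
    filter_upwards [H.prod_mk hnhds] with z hz
    exact (hz.1.chartPatch_of_mem_source hz.2.1 hz.2.2).symm
  · refine (hf.continuousAt.tendsto.comp tendsto_snd).congr' ?_
    filter_upwards [(hi.eventually_notMem_image_symm hx).prod_inr l] with z hz
    exact (chartPatch_of_notMem hz).symm

theorem exists_mem_nhds_eventually_injOn_chartPatch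
    (H : ∀ᶠ i in l, IsChartModification φ ψ S f (k i)) (hf : Continuous f)
    (hf_inj : Function.Injective f)
    (hk_inj : ∀ p ∈ chartDomain φ ψ f, ∃ U ∈ 𝓝 p, ∀ᶠ i in l, InjOn (k i) U) (x : M) :
    ∃ U ∈ 𝓝 x, ∀ᶠ i in l, InjOn (chartPatch φ ψ S f (k i)) U := by
  obtain ⟨i, hi⟩ := H.exists
  rcases hi.mem_source_or_notMem_image_symm x with ⟨hx, hfx⟩ | hx
  · obtain ⟨U, hU, hinj⟩ := hk_inj _ (map_mem_chartDomain hx hfx)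
    refine ⟨(φ.source ∩ f ⁻¹' ψ.source) ∩ φ ⁻¹' U, inter_mem (inter_mem (φ.open_source.mem_nhds hx)
      (hf.continuousAt (ψ.open_source.mem_nhds hfx))) (φ.continuousAt hx hU), ?_⟩
    filter_upwards [hinj, H] with i hkU hki y hy z hz hyz
    rw [hki.chartPatch_of_mem_source hy.1.1 hy.1.2,
      hki.chartPatch_of_mem_source hz.1.1 hz.1.2] at hyz
    have hk_eq := ψ.symm.injOn (hki.mapsTo_chartDomain (map_mem_chartDomain hy.1.1 hy.1.2))
      (hki.mapsTo_chartDomain (map_mem_chartDomain hz.1.1 hz.1.2)) hyz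
    exact φ.injOn hy.1.1 hz.1.1 (hkU hy.2 hz.2 hk_eq)
  · refine ⟨_, hi.eventually_notMem_image_symm hx, .of_forall fun i y hy z hz hyz => hf_inj ?_⟩
    rwa [chartPatch_of_notMem hy, chartPatch_of_notMem hz] at hyz

end IsChartModification

end ChartPatch

section SmoothApproximation

namespace IsLocalSmoothing

variable {E : Type*} [NormedAddCommGroup E] [NormedSpace ℝ E]
  {E' : Type*} [NormedAddCommGroup E'] [NormedSpace ℝ E']
  {h : E → E'} {O : Set E} {χ : E → ℝ} {k : ℕ → E → E'}

theorem eventually_mapsTo_tsupport (H : IsLocalSmoothing h O χ k) (hχ : HasCompactSupport χ)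
    (hχO : tsupport χ ⊆ O) {T : Set E'} (hT : IsOpen T) (hhT : MapsTo h O T) :
    ∀ᶠ j in atTop, MapsTo (k j) (tsupport χ) T :=
  eventually_forall_mem_of_isCompact hχ fun _ hp =>
    H.tendsto (hχO hp) (hT.mem_nhds (hhT (hχO hp)))

theorem eventually_coerciveAt (H : IsLocalSmoothing h O χ k) (hχ : HasCompactSupport χ)
    (hχO : tsupport χ ⊆ O) : ∀ᶠ j in atTop, ∀ p ∈ tsupport χ, CoerciveAt (k j) p := by
  refine eventually_forall_mem_of_isCompact hχ fun p hp => ?_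
  obtain ⟨C, U, hU, hk⟩ := H.coerciveOn (hχO hp)
  filter_upwards [hk.prod_mk (eventually_eventually_nhds.2 hU)] with z hz
    using ⟨C, U, hz.2, hz.1⟩

theorem eventually_isChartModification {M N : Type*} [TopologicalSpace M] [T2Space M]
    [TopologicalSpace N] {φ : OpenPartialHomeomorph M E} {ψ : OpenPartialHomeomorph N E'}
    {f : M → N} (H : IsLocalSmoothing (ψ ∘ f ∘ φ.symm) (chartDomain φ ψ f) χ k)
    (hχ : HasCompactSupport χ) (hχO : tsupport χ ⊆ chartDomain φ ψ f) :
    ∀ᶠ j in atTop, IsChartModification φ ψ (tsupport χ) f (k j) := by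
  have himage : IsCompact (φ.symm '' tsupport χ) :=
    hχ.image_of_continuousOn (φ.continuousOn_symm.mono (hχO.trans inter_subset_left))
  filter_upwards [H.eventually_mapsTo_tsupport hχ hχO ψ.open_target
    fun p hp => ψ.map_source hp.2] with j hj
  exact ⟨himage.isClosed, hχO, H.eq_of_notMem_tsupport j, hj, H.continuousOn j⟩

end IsLocalSmoothing

variable {E : Type*} [NormedAddCommGroup E] [NormedSpace ℝ E]
  {M : Type*} [TopologicalSpace M] [ChartedSpace E M]
  {E' : Type*} [NormedAddCommGroup E'] [NormedSpace ℝ E']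
  {N : Type*} [TopologicalSpace N] [ChartedSpace E' N]

namespace IsChartModification

variable {a : M} {b : N} {S : Set E} {f : M → N} {k : E → E'} {x : M}

theorem mCoerciveAt_chartPatch [IsManifold 𝓘(ℝ, E) 1 M] [IsManifold 𝓘(ℝ, E') 1 N]
    (H : IsChartModification (chartAt E a) (chartAt E' b) S f k) (hf : Continuous f)
    (hk : ∀ p ∈ S, CoerciveAt k p) (hfx : MCoerciveAt E E' f x) :
    MCoerciveAt E E' (chartPatch (chartAt E a) (chartAt E' b) S f k) x := by
  by_cases hxS : x ∈ (chartAt E a).symm '' S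
  · obtain ⟨hx, hfxb⟩ := (H.mem_source_or_notMem_image_symm x).resolve_right (not_not.2 hxS)
    obtain ⟨p, hp, rfl⟩ := hxS
    refine (mCoerciveAt_iff (H.continuous_chartPatch hf).continuousAt hx
      (H.chartPatch_mem_source hx hfxb)).2 ?_
    refine CoerciveAt.congr ?_ (H.chart_comp_chartPatch_eventuallyEq hf hx hfxb)
    rw [(chartAt E a).right_inv (H.subset_chartDomain hp).1]
    exact hk p hp
  · exact hfx.congr (H.chartPatch_eventuallyEq hxS)

variable [IsManifold 𝓘(ℝ, E) ∞ M] [IsManifold 𝓘(ℝ, E') ∞ N]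

theorem contMDiffAt_chartPatch_of_contDiffAt
    (H : IsChartModification (chartAt E a) (chartAt E' b) S f k) (hf : Continuous f)
    (hx : x ∈ (chartAt E a).source) (hfx : f x ∈ (chartAt E' b).source)
    (hk : ContDiffAt ℝ ∞ k (chartAt E a x)) :
    ContMDiffAt 𝓘(ℝ, E) 𝓘(ℝ, E') ∞ (chartPatch (chartAt E a) (chartAt E' b) S f k) x :=
  (contMDiffAt_iff_contDiffAt_chartAt (H.continuous_chartPatch hf).continuousAt hx
    (H.chartPatch_mem_source hx hfx)).2
    (hk.congr_of_eventuallyEq (H.chart_comp_chartPatch_eventuallyEq hf hx hfx))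

theorem contMDiffAt_chartPatch_of_contMDiffAt
    (H : IsChartModification (chartAt E a) (chartAt E' b) S f k) (hf : Continuous f)
    (hk : ∀ p, ContDiffAt ℝ ∞ (chartAt E' b ∘ f ∘ (chartAt E a).symm) p → ContDiffAt ℝ ∞ k p)
    (hfx : ContMDiffAt 𝓘(ℝ, E) 𝓘(ℝ, E') ∞ f x) :
    ContMDiffAt 𝓘(ℝ, E) 𝓘(ℝ, E') ∞ (chartPatch (chartAt E a) (chartAt E' b) S f k) x := by
  rcases H.mem_source_or_notMem_image_symm x with ⟨hx, hfxb⟩ | hx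
  · exact H.contMDiffAt_chartPatch_of_contDiffAt hf hx hfxb
      (hk _ ((contMDiffAt_iff_contDiffAt_chartAt hf.continuousAt hx hfxb).1 hfx))
  · exact hfx.congr_of_eventuallyEq (H.chartPatch_eventuallyEq hx)

end IsChartModification

variable (E E') in
/-- Injective and everywhere coercive maps between manifolds: the bi-Lipschitz counterpart of
injective immersions. -/
structure IsCoerciveEmbedding (f : M → N) : Prop where
  injective : Function.Injective f
  mCoerciveAt (x : M) : MCoerciveAt E E' f x

theorem IsCoerciveEmbedding.coerciveAt_of_mem_chartDomain [IsManifold 𝓘(ℝ, E) 1 M]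
    [IsManifold 𝓘(ℝ, E') 1 N] {f : M → N} (hf : IsCoerciveEmbedding E E' f)
    (hfc : Continuous f) {a : M} {b : N} {p : E}
    (hp : p ∈ chartDomain (chartAt E a) (chartAt E' b) f) :
    CoerciveAt (chartAt E' b ∘ f ∘ (chartAt E a).symm) p := by
  have h := (mCoerciveAt_iff hfc.continuousAt ((chartAt E a).map_target hp.1) hp.2).1
    (hf.mCoerciveAt _)
  rwa [(chartAt E a).right_inv hp.1] at h

variable (E E') in
/-- `g` is a coercive embedding that is smooth wherever `f` is and, in addition, on `K`. -/
structure IsSmootherEmbedding (f : M → N) (K : Set M) (g : M → N) : Prop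
    extends IsCoerciveEmbedding E E' g where
  contMDiffAt {x : M} :
    ContMDiffAt 𝓘(ℝ, E) 𝓘(ℝ, E') ∞ f x → ContMDiffAt 𝓘(ℝ, E) 𝓘(ℝ, E') ∞ g x
  contMDiffAt_of_mem {x : M} : x ∈ K → ContMDiffAt 𝓘(ℝ, E) 𝓘(ℝ, E') ∞ g x

theorem IsSmootherEmbedding.trans {f g h : M → N} {K L : Set M}
    (hfg : IsSmootherEmbedding E E' f K g) (hgh : IsSmootherEmbedding E E' g L h) :
    IsSmootherEmbedding E E' f (K ∪ L) h where
  toIsCoerciveEmbedding := hgh.toIsCoerciveEmbedding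
  contMDiffAt hx := hgh.contMDiffAt (hfg.contMDiffAt hx)
  contMDiffAt_of_mem hx :=
    hx.elim (fun hK => hgh.contMDiffAt (hfg.contMDiffAt_of_mem hK)) hgh.contMDiffAt_of_mem

variable (E E') in
/-- Near `F`, arbitrarily small perturbations make coercive embeddings smooth on `K`. -/
def SmoothableNear (F : C(M, N)) (K : Set M) : Prop :=
  ∀ᶠ f : C(M, N) in 𝓝 F, IsCoerciveEmbedding E E' f →
    ∃ᶠ g : C(M, N) in 𝓝 f, IsSmootherEmbedding E E' f K g

theorem SmoothableNear.empty (F : C(M, N)) : SmoothableNear E E' F ∅ :=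
  .of_forall fun f hf =>
    (frequently_pure.2 ⟨hf, id, fun hx => hx.elim⟩).filter_mono (pure_le_nhds f)

theorem SmoothableNear.mono {F : C(M, N)} {K L : Set M} (hL : SmoothableNear E E' F L)
    (hKL : K ⊆ L) : SmoothableNear E E' F K :=
  Eventually.mono hL fun _ H hf => (H hf).mono fun _ hg => { hg with
    contMDiffAt_of_mem := fun hx => hg.contMDiffAt_of_mem (hKL hx) }

theorem SmoothableNear.union {F : C(M, N)} {K L : Set M} (hK : SmoothableNear E E' F K)
    (hL : SmoothableNear E E' F L) : SmoothableNear E E' F (K ∪ L) := by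
  filter_upwards [hK, eventually_eventually_nhds.2 hL] with f hfK hfL hf
  refine frequently_frequently_nhds.1 (((hfK hf).and_eventually hfL).mono fun g ⟨hg, hgL⟩ => ?_)
  exact (hgL hg.toIsCoerciveEmbedding).mono fun h hh => hg.trans hh

variable [IsManifold 𝓘(ℝ, E) ∞ M] [IsManifold 𝓘(ℝ, E') ∞ N] [FiniteDimensional ℝ E]
  [CompleteSpace E'] [CompactSpace M] [T2Space M] [T2Space N]

theorem IsCoerciveEmbedding.frequently_isSmootherEmbedding {f : C(M, N)}
    (hf : IsCoerciveEmbedding E E' f) {a : M} {b : N} {χ : E → ℝ} (hχ : ContDiff ℝ ∞ χ)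
    (hχ₀₁ : ∀ p, χ p ∈ Icc 0 1) (hχc : HasCompactSupport χ)
    (hχO : tsupport χ ⊆ chartDomain (chartAt E a) (chartAt E' b) f) :
    ∃ᶠ g : C(M, N) in 𝓝 f, IsSmootherEmbedding E E' f
      {x ∈ (chartAt E a).source | χ =ᶠ[𝓝 (chartAt E a x)] 1} g := by
  have : IsManifold 𝓘(ℝ, E) 1 M := .of_le (n := ∞) (by simp)
  have : IsManifold 𝓘(ℝ, E') 1 N := .of_le (n := ∞) (by simp)
  have hfc := f.continuous
  obtain ⟨k, H⟩ := exists_isLocalSmoothing (isOpen_chartDomain hfc)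
    (fun p hp => hf.coerciveAt_of_mem_chartDomain hfc hp) hχ hχ₀₁ hχc hχO
  have hk := H.eventually_isChartModification hχc hχO
  have hlim := IsChartModification.tendsto_chartPatch hk hfc fun p hp => H.tendsto hp
  have hinj := eventually_injective_of_forall_tendsto_prod hf.injective hlim <|
    IsChartModification.exists_mem_nhds_eventually_injOn_chartPatch hk hfc hf.injective
      fun p hp => let ⟨C, U, hU, hC⟩ := H.coerciveOn hp; ⟨U, hU, hC.mono fun _ h => h.injOn⟩
  obtain ⟨G, hG, hGlim⟩ :=
    exists_tendsto_continuousMap (hk.mono fun j hj => hj.continuous_chartPatch hfc) hlim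
  refine hGlim.frequently (Eventually.frequently ?_)
  filter_upwards [hG, hinj, hk, H.eventually_coerciveAt hχc hχO] with j hGj hj_inj hj hj_coer
  rw [hGj]
  refine ⟨⟨hj_inj, fun x => hj.mCoerciveAt_chartPatch hfc hj_coer (hf.mCoerciveAt x)⟩,
    hj.contMDiffAt_chartPatch_of_contMDiffAt hfc fun p => H.contDiffAt j, fun {x} ⟨hx, hχx⟩ => ?_⟩
  have hxS : chartAt E a x ∈ tsupport χ := subset_tsupport χ (by simp [hχx.eq_of_nhds])
  exact hj.contMDiffAt_chartPatch_of_contDiffAt hfc hx (by simpa [hx] using (hχO hxS).2)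
    (H.contDiffAt_of_eventuallyEq_one j hχx)

theorem exists_mem_nhds_smoothableNear (F : C(M, N)) (x : M) :
    ∃ K ∈ 𝓝 x, SmoothableNear E E' F K := by
  set φ := chartAt E x
  set ψ := chartAt E' (F x)
  have hx := mem_chart_source E x
  obtain ⟨ε, hε, hεO⟩ := Metric.nhds_basis_closedBall.mem_iff.1 <|
    (isOpen_chartDomain F.continuous).mem_nhds
      (map_mem_chartDomain (φ := φ) (ψ := ψ) hx (mem_chart_source E' (F x)))
  let χ : ContDiffBump (φ x) := ⟨ε / 2, ε, half_pos hε, half_lt_self hε⟩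
  have hχφ : tsupport χ ⊆ φ.target := χ.tsupport_eq.trans_subset (hεO.trans inter_subset_left)
  refine ⟨{y ∈ φ.source | χ =ᶠ[𝓝 (φ y)] 1}, inter_mem (φ.open_source.mem_nhds hx)
    (φ.continuousAt hx (eventually_eventually_nhds.2 χ.eventuallyEq_one)), ?_⟩
  have hχc : IsCompact (φ.symm '' tsupport χ) :=
    χ.hasCompactSupport.image_of_continuousOn (φ.continuousOn_symm.mono hχφ)
  have hF : MapsTo F (φ.symm '' tsupport χ) ψ.source := by
    rintro _ ⟨p, hp, rfl⟩
    exact (hεO (χ.tsupport_eq.subset hp)).2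
  filter_upwards [ContinuousMap.eventually_mapsTo hχc ψ.open_source hF] with f hf hf_emb
  exact hf_emb.frequently_isSmootherEmbedding χ.contDiff (fun p => ⟨χ.nonneg, χ.le_one⟩)
    χ.hasCompactSupport fun p hp => ⟨hχφ hp, hf (mem_image_of_mem _ hp)⟩

theorem frequently_smooth_isCoerciveEmbedding {F : C(M, N)} (hF : IsCoerciveEmbedding E E' F) :
    ∃ᶠ g : C(M, N) in 𝓝 F,
      IsCoerciveEmbedding E E' g ∧ ContMDiff 𝓘(ℝ, E) 𝓘(ℝ, E') ∞ g := by
  have huniv : SmoothableNear E E' F univ :=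
    isCompact_univ.induction_on (SmoothableNear.empty F) (fun _ _ hst ht => ht.mono hst)
      (fun _ _ => SmoothableNear.union)
      fun x _ => by simpa using exists_mem_nhds_smoothableNear F x
  exact (huniv.self_of_nhds hF).mono fun g hg =>
    ⟨hg.toIsCoerciveEmbedding, fun x => hg.contMDiffAt_of_mem (mem_univ x)⟩

end SmoothApproximation

section LocalDiffeomorphism

variable {E : Type*} [NormedAddCommGroup E] [NormedSpace ℝ E]
  {M : Type*} [TopologicalSpace M] [ChartedSpace E M] [IsManifold 𝓘(ℝ, E) ∞ M]
  {E' : Type*} [NormedAddCommGroup E'] [NormedSpace ℝ E']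
  {N : Type*} [TopologicalSpace N] [ChartedSpace E' N] [IsManifold 𝓘(ℝ, E') ∞ N]
  {f : M → N}

theorem contDiffAt_of_mem_chartDomain (hf : ContMDiff 𝓘(ℝ, E) 𝓘(ℝ, E') ∞ f) {a : M} {b : N}
    {p : E} (hp : p ∈ chartDomain (chartAt E a) (chartAt E' b) f) :
    ContDiffAt ℝ ∞ (chartAt E' b ∘ f ∘ (chartAt E a).symm) p := by
  have h := (contMDiffAt_iff_contDiffAt_chartAt hf.continuous.continuousAt
    ((chartAt E a).map_target hp.1) hp.2).1 (hf _)
  rwa [(chartAt E a).right_inv hp.1] at h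

theorem isLocalDiffeomorphAt_of_openPartialHomeomorph
    (hf : ContMDiff 𝓘(ℝ, E) 𝓘(ℝ, E') ∞ f) {x : M} {e : OpenPartialHomeomorph E E'}
    (hx : chartAt E x x ∈ e.source)
    (he : e.source ⊆ chartDomain (chartAt E x) (chartAt E' (f x)) f)
    (he_eq : EqOn e (chartAt E' (f x) ∘ f ∘ (chartAt E x).symm) e.source)
    (he_symm : ContDiffOn ℝ ∞ e.symm e.target) :
    IsLocalDiffeomorphAt 𝓘(ℝ, E) 𝓘(ℝ, E') ∞ f x := by
  set φ := chartAt E x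
  set ψ := chartAt E' (f x)
  let T : OpenPartialHomeomorph M N := φ ≫ₕ e ≫ₕ ψ.symm
  have hT : EqOn f T T.source := fun y hy => by
    have hyφ : y ∈ φ.source := hy.1
    have hye : φ y ∈ e.source := hy.2.1
    calc f y = ψ.symm (ψ (f (φ.symm (φ y)))) := by rw [ψ.left_inv (he hye).2, φ.left_inv hyφ]
      _ = ψ.symm (e (φ y)) := by rw [he_eq hye]; rfl
  have hψ_smooth : ContMDiffOn 𝓘(ℝ, E') 𝓘(ℝ, E') ∞ ψ ψ.source := contMDiffOn_chart
  have hφ_smooth : ContMDiffOn 𝓘(ℝ, E) 𝓘(ℝ, E) ∞ φ.symm φ.target := contMDiffOn_chart_symm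
  have hT_symm := hφ_smooth.comp' (he_symm.contMDiffOn.comp' hψ_smooth)
  refine ⟨⟨T.toPartialEquiv, T.open_source, T.open_target,
    hf.contMDiffOn.congr fun y hy => (hT hy).symm, hT_symm.mono fun z hz => ?_⟩, ?_, hT⟩
  · simpa only [T, mfld_simps] using hz
  · have hxψ : e (φ x) ∈ ψ.target := by
      rw [he_eq hx]
      exact ψ.map_source (he hx).2
    exact ⟨mem_chart_source E x, hx, hxψ⟩

theorem isLocalDiffeomorphAt_of_forall_hasFDerivAt_equiv [CompleteSpace E]
    (hf : ContMDiff 𝓘(ℝ, E) 𝓘(ℝ, E') ∞ f) {x : M}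
    (hderiv : ∀ p ∈ chartDomain (chartAt E x) (chartAt E' (f x)) f, ∃ A : E ≃L[ℝ] E',
      HasFDerivAt (chartAt E' (f x) ∘ f ∘ (chartAt E x).symm) (A : E →L[ℝ] E') p) :
    IsLocalDiffeomorphAt 𝓘(ℝ, E) 𝓘(ℝ, E') ∞ f x := by
  have hx := map_mem_chartDomain (mem_chart_source E x) (mem_chart_source E' (f x))
  obtain ⟨A, hA⟩ := hderiv _ hx
  have hx_smooth := contDiffAt_of_mem_chartDomain hf hx
  let e : OpenPartialHomeomorph E E' :=
    (hx_smooth.toOpenPartialHomeomorph _ hA (by simp)).restrOpen _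
      (isOpen_chartDomain (φ := chartAt E x) (ψ := chartAt E' (f x)) hf.continuous)
  have he : e.source ⊆ chartDomain (chartAt E x) (chartAt E' (f x)) f := inter_subset_right
  refine isLocalDiffeomorphAt_of_openPartialHomeomorph hf (e := e)
    ⟨hx_smooth.mem_toOpenPartialHomeomorph_source hA (by simp), hx⟩ he (fun _ _ => rfl)
    fun q hq => ?_
  have hq_mem := he (e.map_target hq)
  obtain ⟨B, hB⟩ := hderiv _ hq_mem
  exact (e.contDiffAt_symm hq hB (contDiffAt_of_mem_chartDomain hf hq_mem)).contDiffWithinAt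

theorem IsCoerciveEmbedding.isLocalDiffeomorph [FiniteDimensional ℝ E] [FiniteDimensional ℝ E']
    (hf : IsCoerciveEmbedding E E' f) (hf_smooth : ContMDiff 𝓘(ℝ, E) 𝓘(ℝ, E') ∞ f)
    (hdim : Module.finrank ℝ E = Module.finrank ℝ E') :
    IsLocalDiffeomorph 𝓘(ℝ, E) 𝓘(ℝ, E') ∞ f := fun x => by
  have : IsManifold 𝓘(ℝ, E) 1 M := .of_le (n := ∞) (by simp)
  have : IsManifold 𝓘(ℝ, E') 1 N := .of_le (n := ∞) (by simp)
  refine isLocalDiffeomorphAt_of_forall_hasFDerivAt_equiv hf_smooth fun p hp => ?_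
  have hderiv := ((contDiffAt_of_mem_chartDomain hf_smooth hp).differentiableAt
    (by simp)).hasFDerivAt
  have hinj := (hf.coerciveAt_of_mem_chartDomain hf_smooth.continuous hp).injective_of_hasFDerivAt
    hderiv
  exact ⟨(LinearEquiv.ofInjectiveOfFinrankEq _ hinj hdim).toContinuousLinearEquiv, hderiv⟩

end LocalDiffeomorphism

section Components

variable {X Y : Type*} [TopologicalSpace X] [CompactSpace X] [TopologicalSpace Y]

theorem eventually_forall_mem_connectedComponent [R1Space X] [LocallyConnectedSpace Y]
    (F : C(X, Y)) :
    ∀ᶠ g : C(X, Y) in 𝓝 F, ∀ x, g x ∈ connectedComponent (F x) := by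
  suffices h : ∀ᶠ g : C(X, Y) in 𝓝 F, ∀ x ∈ univ, g x ∈ connectedComponent (F x) by simpa using h
  refine eventually_forall_mem_of_isCompact isCompact_univ fun x _ => ?_
  have hmem : connectedComponent (F x) ∈ 𝓝 (F x) :=
    isOpen_connectedComponent.mem_nhds mem_connectedComponent
  have heval : ∀ᶠ z : C(X, Y) × X in 𝓝 F ×ˢ 𝓝 x, z.1 z.2 ∈ connectedComponent (F x) := by
    rw [← nhds_prod_eq]
    exact (ContinuousEval.continuous_eval.tendsto (F, x)).eventually hmem
  have hF : ∀ᶠ z : C(X, Y) × X in 𝓝 F ×ˢ 𝓝 x, F z.2 ∈ connectedComponent (F x) :=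
    tendsto_snd.eventually (F.continuous.continuousAt.eventually hmem)
  filter_upwards [heval, hF] with z hz hFz
  rwa [← connectedComponent_eq hFz]

theorem surjective_of_forall_mem_connectedComponent [T2Space Y] {F g : X → Y}
    (hF : Function.Surjective F) (hg : Continuous g) (hopen : IsOpen (range g))
    (h : ∀ x, g x ∈ connectedComponent (F x)) : Function.Surjective g := fun y => by
  obtain ⟨x, rfl⟩ := hF y
  have hclopen : IsClopen (range g) := ⟨(isCompact_range hg).isClosed, hopen⟩
  have hsub := hclopen.connectedComponent_subset (mem_range_self x)
  rw [← connectedComponent_eq (h x)] at hsub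
  exact hsub mem_connectedComponent

end Components

theorem nonempty_diffeomorph_of_isCoerciveEmbedding
    {E : Type*} [NormedAddCommGroup E] [NormedSpace ℝ E] [FiniteDimensional ℝ E]
    {M : Type*} [TopologicalSpace M] [CompactSpace M] [T2Space M] [ChartedSpace E M]
    [IsManifold 𝓘(ℝ, E) ∞ M]
    {E' : Type*} [NormedAddCommGroup E'] [NormedSpace ℝ E'] [FiniteDimensional ℝ E']
    {N : Type*} [TopologicalSpace N] [T2Space N] [ChartedSpace E' N] [IsManifold 𝓘(ℝ, E') ∞ N]
    {F : M → N} (hdim : Module.finrank ℝ E = Module.finrank ℝ E')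
    (hF : IsCoerciveEmbedding E E' F) (hF_surj : Function.Surjective F) (hFc : Continuous F) :
    Nonempty (M ≃ₘ^∞⟮𝓘(ℝ, E), 𝓘(ℝ, E')⟯ N) := by
  have : LocallyConnectedSpace N := ChartedSpace.locallyConnectedSpace E' N
  have : CompleteSpace E' := FiniteDimensional.complete ℝ E'
  obtain ⟨g, ⟨hg, hg_smooth⟩, hg_comp⟩ :=
    ((frequently_smooth_isCoerciveEmbedding (F := ⟨F, hFc⟩) hF).and_eventually
      (eventually_forall_mem_connectedComponent _)).exists
  have hg_diff := hg.isLocalDiffeomorph hg_smooth hdim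
  have hg_surj := surjective_of_forall_mem_connectedComponent hF_surj g.continuous
    hg_diff.isOpen_range hg_comp
  exact ⟨hg_diff.diffeomorphOfBijective ⟨hg.injective, hg_surj⟩⟩

section ClarkeDifferential

variable {E : Type*} [NormedAddCommGroup E] [NormedSpace ℝ E]
  {M : Type*} [TopologicalSpace M] [ChartedSpace E M] [IsManifold 𝓘(ℝ, E) 1 M]
  {E' : Type*} [NormedAddCommGroup E'] [NormedSpace ℝ E']
  {N : Type*} [TopologicalSpace N] [ChartedSpace E' N] [IsManifold 𝓘(ℝ, E') 1 N]
  {F : M → N}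

theorem limitFDerivs_subset_limitDifferentials (hF : Continuous F) (x : M) :
    limitFDerivs (chartAt E' (F x) ∘ F ∘ (chartAt E x).symm) (chartAt E x x) ⊆
      limitDifferentials 𝓘(ℝ, E) 𝓘(ℝ, E') F x := fun A hA => by
  obtain ⟨q, hqA, hq⟩ := MapClusterPt.exists_seq_tendsto hA
  obtain ⟨hqx, hq_diff⟩ := tendsto_nhdsWithin_iff.1 hq
  set φ := chartAt E x
  set ψ := chartAt E' (F x)
  have hx := map_mem_chartDomain (f := F) (mem_chart_source E x) (mem_chart_source E' (F x))
  have hq_mem := hqx.eventually ((isOpen_chartDomain hF).mem_nhds hx)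
  obtain ⟨n, hn⟩ := eventually_atTop.1 (hq_mem.and hq_diff)
  have hshift : Tendsto (fun i => i + n) atTop atTop := tendsto_add_atTop_nat n
  have hn' (i : ℕ) := hn (i + n) (Nat.le_add_left n i)
  refine ⟨fun i => φ.symm (q (i + n)), fun i => ?_, ?_, ?_⟩
  · obtain ⟨⟨hqφ, hqψ⟩, hdiff⟩ := hn' i
    refine (mdifferentiableAt_iff_of_mem_source (φ.map_target hqφ) hqψ).2
      ⟨hF.continuousAt, DifferentiableAt.differentiableWithinAt ?_⟩
    rw [← φ.right_inv hqφ] at hdiff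
    exact hdiff
  · have hlim := (φ.continuousAt_symm hx.1).tendsto.comp (hqx.comp hshift)
    rwa [φ.left_inv (mem_chart_source E x)] at hlim
  · refine (hqA.comp hshift).congr fun i => ?_
    have hq_inv : extChartAt 𝓘(ℝ, E) x (φ.symm (q (i + n))) = q (i + n) :=
      φ.right_inv (hn' i).1.1
    rw [hq_inv, modelWithCornersSelf_coe, range_id, fderivWithin_univ]
    rfl

end ClarkeDifferential

theorem injective_of_finrank_range_eq {k V V' : Type*} [Field k] [AddCommGroup V] [Module k V]
    [FiniteDimensional k V] [AddCommGroup V'] [Module k V'] {A : V →ₗ[k] V'}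
    (h : Module.finrank k (LinearMap.range A) = Module.finrank k V) : Function.Injective A := by
  have hker : Module.finrank k (LinearMap.ker A) = 0 := by
    have := A.finrank_range_add_finrank_ker
    omega
  exact LinearMap.ker_eq_bot.1 (Submodule.finrank_eq_zero.1 hker)

theorem isContinuousRiemannianBundle_of_isContMDiffRiemannianBundle
    {E : Type*} [NormedAddCommGroup E] [NormedSpace ℝ E]
    {H : Type*} [TopologicalSpace H] (I : ModelWithCorners ℝ E H)
    {M : Type*} [TopologicalSpace M] [ChartedSpace H M]
    {F : Type*} [NormedAddCommGroup F] [NormedSpace ℝ F]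
    {V : M → Type*} [TopologicalSpace (Bundle.TotalSpace F V)] [∀ x, NormedAddCommGroup (V x)]
    [∀ x, InnerProductSpace ℝ (V x)] [FiberBundle F V] [VectorBundle ℝ F V] (k : ℕ∞ω)
    [h : IsContMDiffRiemannianBundle I k F V] : IsContinuousRiemannianBundle F V := by
  obtain ⟨g, hg, hg_inner⟩ := h.exists_contMDiff
  exact ⟨g, hg.continuous, hg_inner⟩

section RiemannianManifold

variable {E : Type*} [NormedAddCommGroup E] [NormedSpace ℝ E] [FiniteDimensional ℝ E]
  {M : Type*} [EMetricSpace M] [ChartedSpace E M] [IsManifold 𝓘(ℝ, E) ∞ M]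
  [Bundle.RiemannianBundle (fun x : M => TangentSpace 𝓘(ℝ, E) x)]
  [IsContinuousRiemannianBundle E (fun x : M => TangentSpace 𝓘(ℝ, E) x)]
  [IsRiemannianManifold 𝓘(ℝ, E) M]
  {E' : Type*} [NormedAddCommGroup E'] [NormedSpace ℝ E'] [FiniteDimensional ℝ E']
  {N : Type*} [EMetricSpace N] [ChartedSpace E' N] [IsManifold 𝓘(ℝ, E') ∞ N]
  [Bundle.RiemannianBundle (fun y : N => TangentSpace 𝓘(ℝ, E') y)]
  [IsContinuousRiemannianBundle E' (fun y : N => TangentSpace 𝓘(ℝ, E') y)]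
  [IsRiemannianManifold 𝓘(ℝ, E') N]

theorem IsClarkeNonsingularAt.mCoerciveAt {F : M → N} {x : M}
    (hx : IsClarkeNonsingularAt 𝓘(ℝ, E) 𝓘(ℝ, E') F x)
    (hdim : Module.finrank ℝ E ≤ Module.finrank ℝ E') {K : ℝ≥0} (hF : LipschitzWith K F) :
    MCoerciveAt E E' F x := by
  have : IsManifold 𝓘(ℝ, E) 1 M := .of_le (n := ∞) (by simp)
  have : IsManifold 𝓘(ℝ, E') 1 N := .of_le (n := ∞) (by simp)
  obtain ⟨L, U, hU, hL⟩ := exists_lipschitzOnWith_chartAt_comp (E := E) (E' := E') hF x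
  refine coerciveAt_of_forall_injective hU hL fun A hA => injective_of_finrank_range_eq ?_
  rw [hx A (convexHull_mono (limitFDerivs_subset_limitDifferentials hF.continuous x) hA),
    min_eq_left hdim]

theorem mainTheorem2_general [CompactSpace M] (F : M ≃ₜ N)
    (hF : ∃ K : ℝ≥0, LipschitzWith K F)
    (hFsymm : ∃ K : ℝ≥0, LipschitzWith K F.symm)
    (hsing : ∀ x : M, IsClarkeNonsingularAt 𝓘(ℝ, E) 𝓘(ℝ, E') F x) :
    Nonempty (M ≃ₘ^∞⟮𝓘(ℝ, E), 𝓘(ℝ, E')⟯ N) := by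
  have : IsManifold 𝓘(ℝ, E) 1 M := .of_le (n := ∞) (by simp)
  have : IsManifold 𝓘(ℝ, E') 1 N := .of_le (n := ∞) (by simp)
  obtain ⟨K, hK⟩ := hF
  obtain ⟨K', hK'⟩ := hFsymm
  rcases isEmpty_or_nonempty M with hM | ⟨⟨x₀⟩⟩
  · have : IsEmpty N := F.symm.toEquiv.isEmpty
    exact ⟨⟨F.toEquiv, isEmptyElim, isEmptyElim⟩⟩
  have hdim : Module.finrank ℝ E = Module.finrank ℝ E' :=
    le_antisymm (finrank_le_of_lipschitzWith_homeomorph F.symm hK' (F x₀))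
      (finrank_le_of_lipschitzWith_homeomorph F hK x₀)
  have hF_coercive : IsCoerciveEmbedding E E' F :=
    ⟨F.injective, fun x => (hsing x).mCoerciveAt hdim.le hK⟩
  exact nonempty_diffeomorph_of_isCoerciveEmbedding hdim hF_coercive F.surjective F.continuous

end RiemannianManifold

theorem mainTheorem2 {m n : ℕ}
    {M : Type*} [EMetricSpace M] [CompactSpace M]
    [ChartedSpace (EuclideanSpace ℝ (Fin m)) M] [IsManifold (𝓡 m) ∞ M]
    [Bundle.RiemannianBundle (fun x : M => TangentSpace (𝓡 m) x)]
    [IsContMDiffRiemannianBundle (𝓡 m) ∞ (EuclideanSpace ℝ (Fin m))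
      (fun x : M => TangentSpace (𝓡 m) x)]
    [IsRiemannianManifold (𝓡 m) M]
    {N : Type*} [EMetricSpace N]
    [ChartedSpace (EuclideanSpace ℝ (Fin n)) N] [IsManifold (𝓡 n) ∞ N]
    [Bundle.RiemannianBundle (fun y : N => TangentSpace (𝓡 n) y)]
    [IsContMDiffRiemannianBundle (𝓡 n) ∞ (EuclideanSpace ℝ (Fin n))
      (fun y : N => TangentSpace (𝓡 n) y)]
    [IsRiemannianManifold (𝓡 n) N]
    (F : M ≃ₜ N)
    (hF : ∃ K : ℝ≥0, LipschitzWith K F)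
    (hFsymm : ∃ K : ℝ≥0, LipschitzWith K F.symm)
    (hsing : ∀ x : M, IsClarkeNonsingularAt (𝓡 m) (𝓡 n) F x)
    (hsing_symm : ∀ y : N, IsClarkeNonsingularAt (𝓡 n) (𝓡 m) F.symm y) :
    Nonempty (M ≃ₘ^∞⟮𝓡 m, 𝓡 n⟯ N) := by
  have := isContinuousRiemannianBundle_of_isContMDiffRiemannianBundle (𝓡 m)
    (F := EuclideanSpace ℝ (Fin m)) (V := fun x : M => TangentSpace (𝓡 m) x) ∞
  have := isContinuousRiemannianBundle_of_isContMDiffRiemannianBundle (𝓡 n)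
    (F := EuclideanSpace ℝ (Fin n)) (V := fun y : N => TangentSpace (𝓡 n) y) ∞
  exact mainTheorem2_general F hF hFsymm hsing
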